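/- **Setting.** Let $d\ge 1$ and let $\lambda^1,\dots,\lambda^d:[0,1]^d\to\mathbb R$ satisfy, for some constants $L\ge 0$ and $c>0$, * $|\lambda^\gamma(\mathbf u)-\lambda^\gamma(\mathbf v)|\le L\sum_{\gamma'=1}^d|u^{\gamma'}-v^{\gamma'}|$ for all $\gamma$ and all $\mathbf u,\mathbf v\in[0,1]^d$; * $\inf_{[0,1]^d}\lambda^{\gamma}-\sup_{[0,1]^d}\lambda^{\gamma+1}\ge c$ for all $1\le\gamma\le d-1$. **Sticky particles.** For $\bar\lambda\in\mathbb R^n$ and $x_1\le\dots\le x_n$, the *initial cluster* of $k$ is the largest set of consecutive indices $\{a,\dots,b\}\ni k$ with $x_a=\dots=x_b$ and $\frac1{j-a+1}\sum_{i=a}^j\bar\lambda_i\ge\frac1{b-j}\sum_{i=j+1}^b\bar\lambda_i$ for all $a\le j<b$. In the sticky particle dynamics started at $x$ with initial velocities $\bar\lambda$, each cluster moves at constant velocity, equal to the average of $\bar\lambda$ over the cluster, up to the first collision of clusters; colliding clusters stick together, and the dynamics restarts from the configuration reached, with the same $\bar\lambda$. **Multitype sticky particle dynamics (MSPD).** For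 $\mathbf x=(x^\gamma_k)_{1\le\gamma\le d,\,1\le k\le n}$ with $x^\gamma_1\le\dots\le x^\gamma_n$ for all $\gamma$, put $\omega^{\gamma'}_{\gamma:k}=\frac1n\#\{k':x^{\gamma'}_{k'}<x^\gamma_k\}$ if $\gamma'<\gamma$, $\omega^{\gamma'}_{\gamma:k}=\frac1n\#\{k':x^{\gamma'}_{k'}\le x^\gamma_k\}$ if $\gamma'>\gamma$, and $$\tilde\lambda^\gamma_k(\mathbf x)=n\int_{(k-1)/n}^{k/n}\lambda^\gamma\bigl(\omega^1_{\gamma:k},\dots,\omega^{\gamma-1}_{\gamma:k},w,\omega^{\gamma+1}_{\gamma:k},\dots,\omega^d_{\gamma:k}\bigr)\,dw .$$ The MSPD $(\Phi^\gamma_k(\mathbf x;t))_{t\ge0}$ started at $\mathbf x$ is defined as follows: the particles of each type $\gamma$ follow the sticky particle dynamics with initial velocities $(\tilde\lambda^\gamma_k(\mathbf x))_{1\le k\le n}$ up to the first time $t^*>0$ at which, for some $\alpha<\beta$, a particle of type $\alpha$ meets a particle of type $\beta$ that was initially strictly to its right; at time $t^*$ the dynamics restarts from the configuration reached. **Limit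 solutions.** Let $m^1,\dots,m^d$ be probability measures on $\mathbb R$, and let $(\mathbf x(n))_{n\ge1}$ be ordered configurations of $n$ particles of each type such that $\frac1n\sum_{k=1}^n\delta_{x^\gamma_k(n)}\to m^\gamma$ weakly for each $\gamma$. Assume that, along some subsequence, the empirical measures $\frac1n\sum_{k=1}^n\delta_{(\Phi^1_k(\mathbf x(n);t),\dots,\Phi^d_k(\mathbf x(n);t))_{t\ge0}}$ converge weakly to a probability measure $\bar\mu$ on $C([0,\infty),\mathbb R^d)$ (with the topology of locally uniform convergence). Let $u^\gamma(t,\cdot)$ be the distribution function of the $\gamma$-th coordinate at time $t$ under $\bar\mu$. These $\mathbf u=(u^1,\dots,u^d)$ are the solutions of the Cauchy problem $\partial_tu^\gamma+\lambda^\gamma(\mathbf u)\partial_xu^\gamma=0$, with $u^\gamma(0,x)=m^\gamma((-\infty,x])$, that are constructed as limits of the MSPD. **Statement.** Let $\gamma$ be a rarefaction coordinate, that is, let $\lambda^\gamma$ be nondecreasing in its $\gamma$-th argument on $[0,1]^d$. Put $K=\exp((d-1)L/c)$ and, for $v\in(0,1)$, $X^\gamma_v(t)=\inf\{x\in\mathbb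 R:u^\gamma(t,x)\ge v\}$. For a bounded function $F:\mathbb R\to\mathbb R$, put $\omega_F(\delta)=\sup\{|F(x)-F(y)|:|x-y|\le\delta\}$. Then: 1. for all $s\ge0$ and all $v_1\le v_2$ in $(0,1)$, $\ \inf_{t\ge s}\bigl(X^\gamma_{v_2}(t)-X^\gamma_{v_1}(t)\bigr)\ge\frac1K\bigl(X^\gamma_{v_2}(s)-X^\gamma_{v_1}(s)\bigr)$; 2. if $u^\gamma(s,\cdot)$ is continuous on $\mathbb R$ for some $s\ge0$, then $u^\gamma$ is continuous on $[s,\infty)\times\mathbb R$; 3. $\omega_{u^\gamma(t,\cdot)}(\delta)\le\omega_{u^\gamma(s,\cdot)}(K\delta)$ for all $\delta>0$ and $t\ge s\ge0$. -/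

import Mathlib

open Filter Topology MeasureTheory
open scoped NNReal ENNReal

noncomputable section

namespace MSPD

/-! ## Assumptions on the characteristic fields

A family of fields `lam γ : (Fin d → ℝ) → ℝ` is only ever used on the cube `[0,1]^d`, which is
`Set.Icc 0 1` in `Fin d → ℝ`. -/

/-- Lipschitz continuity of the fields on `[0,1]^d`, with constant `L ∈ [0,∞)`. -/
def LipschitzFields {d : ℕ} (lam : Fin d → (Fin d → ℝ) → ℝ) (L : ℝ) : Prop :=
  0 ≤ L ∧ ∀ γ, ∀ u ∈ Set.Icc (0 : Fin d → ℝ) 1, ∀ v ∈ Set.Icc (0 : Fin d → ℝ) 1,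
    |lam γ u - lam γ v| ≤ L * ∑ γ', |u γ' - v γ'|

/-- Uniform strict hyperbolicity with constant `c ∈ (0,∞)`: for consecutive indices,
`inf lam γ - sup lam (γ+1) ≥ c` over the cube. -/
def UniformlyStrictlyHyperbolic {d : ℕ} (lam : Fin d → (Fin d → ℝ) → ℝ) (c : ℝ) : Prop :=
  0 < c ∧ ∀ γ γ' : Fin d, (γ : ℕ) + 1 = (γ' : ℕ) →
    ∀ u ∈ Set.Icc (0 : Fin d → ℝ) 1, ∀ v ∈ Set.Icc (0 : Fin d → ℝ) 1, c ≤ lam γ u - lam γ' v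

/-- `γ` is a rarefaction coordinate: `lam γ` is nondecreasing in its `γ`-th argument. -/
def IsRarefactionCoordinate {d : ℕ} (lam : Fin d → (Fin d → ℝ) → ℝ) (γ : Fin d) : Prop :=
  ∀ u ∈ Set.Icc (0 : Fin d → ℝ) 1, ∀ a ∈ Set.Icc (0 : ℝ) 1, ∀ b ∈ Set.Icc (0 : ℝ) 1,
    a ≤ b → lam γ (Function.update u γ a) ≤ lam γ (Function.update u γ b)

/-! ## The sticky particle dynamics (one type) -/

section Sticky

/-- Average of `lam` over a set of indices. -/
def average {n : ℕ} (lam : Fin n → ℝ) (s : Finset (Fin n)) : ℝ :=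
  (∑ i ∈ s, lam i) / (s.card : ℝ)

/-- The set of consecutive indices `{a, …, b}` is admissible for the configuration `x` and the
initial velocities `lam`: the particles share the same position, and the stability condition
holds, that is, for each splitting the left part is at least as fast as the right part. -/
def IsStableBlock {n : ℕ} (lam x : Fin n → ℝ) (a b : Fin n) : Prop :=
  a ≤ b ∧ (∀ i ∈ Finset.Icc a b, x i = x a) ∧
    ∀ j ∈ Finset.Ico a b, average lam (Finset.Ioc j b) ≤ average lam (Finset.Icc a j)

open scoped Classical in
/-- The initial cluster of the `k`-th particle: the largest admissible set of consecutive indices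
containing `k`. Admissible sets containing `k` are stable under unions, so that the largest one is
the union of all of them. -/
def initialCluster {n : ℕ} (lam x : Fin n → ℝ) (k : Fin n) : Finset (Fin n) :=
  Finset.univ.filter fun i =>
    ∃ a b, IsStableBlock lam x a b ∧ k ∈ Finset.Icc a b ∧ i ∈ Finset.Icc a b

/-- The velocity of a particle is the average of `lam` over its cluster. -/
def clusterVelocity {n : ℕ} (lam x : Fin n → ℝ) (k : Fin n) : ℝ :=
  average lam (initialCluster lam x k)

/-- The number of distinct clusters. -/
def numClusters {n : ℕ} (lam x : Fin n → ℝ) : ℕ :=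
  (Finset.univ.image (initialCluster lam x)).card

/-- Positions at time `t` when each cluster of the configuration `x` moves at constant velocity. -/
def freeFlight {n : ℕ} (lam x : Fin n → ℝ) (t : ℝ) : Fin n → ℝ :=
  fun k => x k + t * clusterVelocity lam x k

/-- The first positive time at which two particles with distinct initial positions meet, if all
clusters move at constant velocity (and `0` if this never happens). Distinct clusters which
share the same position drift apart, so that this is the first collision between clusters. -/
def firstCollision {n : ℕ} (lam x : Fin n → ℝ) : ℝ :=
  sInf {t : ℝ | 0 < t ∧ ∃ i j, x i ≠ x j ∧ freeFlight lam x t i = freeFlight lam x t j}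

/-- The configuration at the first collision between clusters. -/
def afterCollision {n : ℕ} (lam x : Fin n → ℝ) : Fin n → ℝ :=
  freeFlight lam x (firstCollision lam x)

/-- The sticky particle dynamics started at `x` with initial velocity vector `lam`: clusters
travel at constant velocity up to the first collision, where they stick together and the dynamics
restarts. A collision strictly decreases the number of clusters, while `afterCollision lam x = x`
if there is no collision; hence the inequality between numbers of clusters in the test expresses
that there is a collision. -/
def sticky {n : ℕ} (lam x : Fin n → ℝ) (t : ℝ) : Fin n → ℝ :=
  open scoped Classical in
  if _h : numClusters lam (afterCollision lam x) < numClusters lam x ∧ firstCollision lam x ≤ t then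
    sticky lam (afterCollision lam x) (t - firstCollision lam x)
  else freeFlight lam x t
termination_by numClusters lam x
decreasing_by exact _h.1

end Sticky

/-! ## The multitype sticky particle dynamics -/

section Multitype

/-- Positions `x γ k` of the particles `γ:k`, for `γ ∈ {1,…,d}` and `k ∈ {1,…,n}` (here indexed
from `0`). -/
abbrev Config (d n : ℕ) : Type := Fin d → Fin n → ℝ

variable {d n : ℕ}

open scoped Classical in
/-- The set of pairs of particles `(α:i, β:j)` with `α < β` and `x α i < x β j`. -/
def orderedPairs (x : Config d n) : Finset ((Fin d × Fin n) × (Fin d × Fin n)) :=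
  Finset.univ.filter fun p => p.1.1 < p.2.1 ∧ x p.1.1 p.1.2 < x p.2.1 p.2.2

open scoped Classical in
/-- The normalised rank of the particle `γ:k` among the particles of type `γ' ≠ γ`
(irrelevant when `γ' = γ`). -/
def rank (x : Config d n) (γ : Fin d) (k : Fin n) (γ' : Fin d) : ℝ :=
  if γ' < γ then (1 / (n : ℝ)) * ∑ k' : Fin n, if ((γ', k'), (γ, k)) ∈ orderedPairs x then 1 else 0
  else (1 / (n : ℝ)) * ∑ k' : Fin n, if ((γ, k), (γ', k')) ∉ orderedPairs x then 1 else 0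

/-- The initial velocity of the particle `γ:k` in the configuration `x`. -/
def initialVelocity (lam : Fin d → (Fin d → ℝ) → ℝ) (x : Config d n) (γ : Fin d) (k : Fin n) : ℝ :=
  (n : ℝ) * ∫ w in ((k : ℝ) / n)..(((k : ℝ) + 1) / n),
    lam γ (Function.update (rank x γ k) γ w)

/-- The typewise sticky particle dynamics with initial velocities `initialVelocity lam x`. -/
def typewise (lam : Fin d → (Fin d → ℝ) → ℝ) (x : Config d n) (t : ℝ) : Config d n :=
  fun γ => sticky (initialVelocity lam x γ) (x γ) t

/-- The first positive time at which two particles `α:i` and `β:j` with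
`(α:i, β:j) ∈ orderedPairs x` collide in the typewise dynamics (and `0` if there are no such
pairs). -/
def firstTypeCollision (lam : Fin d → (Fin d → ℝ) → ℝ) (x : Config d n) : ℝ :=
  sInf {t : ℝ | 0 < t ∧ ∃ p ∈ orderedPairs x,
    typewise lam x t p.1.1 p.1.2 = typewise lam x t p.2.1 p.2.2}

/-- The configuration at the first collision between particles of different types. -/
def afterTypeCollision (lam : Fin d → (Fin d → ℝ) → ℝ) (x : Config d n) : Config d n :=
  typewise lam x (firstTypeCollision lam x)

/-- The multitype sticky particle dynamics started at `x`: the typewise dynamics up to the first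
collision between particles of different types, where it restarts with the updated velocities.
Under uniform strict hyperbolicity, there is such a collision if and only if `orderedPairs x` is
nonempty, and then its cardinality strictly decreases at the collision; hence the inequality
between cardinalities in the test expresses that there is a collision. -/
def mspd (lam : Fin d → (Fin d → ℝ) → ℝ) (x : Config d n) (t : ℝ) : Config d n :=
  open scoped Classical in
  if _h : (orderedPairs (afterTypeCollision lam x)).card < (orderedPairs x).card ∧
      firstTypeCollision lam x ≤ t then
    mspd lam (afterTypeCollision lam x) (t - firstTypeCollision lam x)
  else typewise lam x t
termination_by (orderedPairs x).card
decreasing_by exact _h.1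

end Multitype

/-! ## Continuity of the trajectories -/

section Continuity

theorem firstCollision_nonneg {n : ℕ} (lam x : Fin n → ℝ) : 0 ≤ firstCollision lam x :=
  Real.sInf_nonneg fun _ ht => ht.1.le

theorem sticky_zero {n : ℕ} (lam x : Fin n → ℝ) : sticky lam x 0 = x := by
  have h0 : freeFlight lam x 0 = x := by
    funext k
    simp [freeFlight]
  rw [sticky, dif_neg, h0]
  rintro ⟨h1, h2⟩
  have h3 : firstCollision lam x = 0 := le_antisymm h2 (firstCollision_nonneg lam x)
  rw [afterCollision, h3, h0] at h1
  exact lt_irrefl _ h1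

theorem continuous_freeFlight {n : ℕ} (lam x : Fin n → ℝ) : Continuous (freeFlight lam x) := by
  unfold freeFlight
  fun_prop

theorem continuous_sticky {n : ℕ} (lam x : Fin n → ℝ) : Continuous (sticky lam x) := by
  classical
  induction hN : numClusters lam x using Nat.strong_induction_on generalizing x with
  | _ N ih =>
    by_cases h : numClusters lam (afterCollision lam x) < numClusters lam x
    · have heq : sticky lam x = fun t => if firstCollision lam x ≤ t then
          sticky lam (afterCollision lam x) (t - firstCollision lam x)
          else freeFlight lam x t := by
        funext t
        rw [sticky]
        by_cases h2 : firstCollision lam x ≤ t <;> simp [h, h2]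
      rw [heq]
      refine Continuous.if_le ?_ (continuous_freeFlight lam x) continuous_const continuous_id ?_
      · exact (ih _ (hN ▸ h) (afterCollision lam x) rfl).comp (continuous_id.sub continuous_const)
      · rintro t rfl
        rw [sub_self, sticky_zero, afterCollision]
    · have heq : sticky lam x = freeFlight lam x := by
        funext t
        rw [sticky]
        simp [h]
      rw [heq]
      exact continuous_freeFlight lam x

variable {d n : ℕ}

theorem continuous_typewise (lam : Fin d → (Fin d → ℝ) → ℝ) (x : Config d n) :
    Continuous (typewise lam x) :=
  continuous_pi fun γ => continuous_sticky (initialVelocity lam x γ) (x γ)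

theorem mspd_zero (lam : Fin d → (Fin d → ℝ) → ℝ) (x : Config d n) : mspd lam x 0 = x := by
  have h0 : typewise lam x 0 = x := by
    funext γ
    exact sticky_zero _ _
  rw [mspd, dif_neg, h0]
  rintro ⟨h1, h2⟩
  have h3 : firstTypeCollision lam x = 0 :=
    le_antisymm h2 (Real.sInf_nonneg fun _ ht => ht.1.le)
  rw [afterTypeCollision, h3, h0] at h1
  exact lt_irrefl _ h1

theorem continuous_mspd (lam : Fin d → (Fin d → ℝ) → ℝ) (x : Config d n) :
    Continuous (mspd lam x) := by
  classical
  induction hN : (orderedPairs x).card using Nat.strong_induction_on generalizing x with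
  | _ N ih =>
    by_cases h : (orderedPairs (afterTypeCollision lam x)).card < (orderedPairs x).card
    · have heq : mspd lam x = fun t => if firstTypeCollision lam x ≤ t then
          mspd lam (afterTypeCollision lam x) (t - firstTypeCollision lam x)
          else typewise lam x t := by
        funext t
        rw [mspd]
        by_cases h2 : firstTypeCollision lam x ≤ t <;> simp [h, h2]
      rw [heq]
      refine Continuous.if_le ?_ (continuous_typewise lam x) continuous_const continuous_id ?_
      · exact (ih _ (hN ▸ h) (afterTypeCollision lam x) rfl).comp
          (continuous_id.sub continuous_const)
      · rintro t rfl
        rw [sub_self, mspd_zero, afterTypeCollision]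
    · have heq : mspd lam x = typewise lam x := by
        funext t
        rw [mspd]
        simp [h]
      rw [heq]
      exact continuous_typewise lam x

end Continuity

/-! ## Empirical distributions and their limits -/

section Limits

/-- The space of sample paths `C([0,∞), ℝ^d)`, with the topology of locally uniform convergence
(the compact-open topology). -/
abbrev PathSpace (d : ℕ) : Type := C(ℝ≥0, Fin d → ℝ)

instance instMeasurableSpacePathSpace (d : ℕ) : MeasurableSpace (PathSpace d) :=
  borel (PathSpace d)

instance instBorelSpacePathSpace (d : ℕ) : BorelSpace (PathSpace d) := ⟨rfl⟩

/-- The empirical probability measure `(1/n) ∑ δ_{f k}` of `n ≥ 1` points. -/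
def empirical {E : Type*} [MeasurableSpace E] {n : ℕ} [NeZero n] (f : Fin n → E) :
    ProbabilityMeasure E :=
  ⟨(n : ℝ≥0∞)⁻¹ • ∑ k, Measure.dirac (f k), ⟨by
    simp [ENNReal.inv_mul_cancel (Nat.cast_ne_zero.mpr (NeZero.ne n))
      (ENNReal.natCast_ne_top n)]⟩⟩

variable {d : ℕ}

/-- The sample path `t ↦ (Φ_k^1(x;t), …, Φ_k^d(x;t))` of the multitype sticky particle dynamics. -/
def mspdPath {n : ℕ} (lam : Fin d → (Fin d → ℝ) → ℝ) (x : Config d n) (k : Fin n) :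
    PathSpace d where
  toFun t := fun γ => mspd lam x (t : ℝ) γ k
  continuous_toFun := by
    have h := (continuous_mspd lam x).comp NNReal.continuous_coe
    exact continuous_pi fun γ => (continuous_apply k).comp ((continuous_apply γ).comp h)

/-- The law on `ℝ` of the `γ`-th coordinate at time `t` under `μ`. -/
def marginal (μ : ProbabilityMeasure (PathSpace d)) (γ : Fin d) (t : ℝ≥0) : ProbabilityMeasure ℝ :=
  μ.map (f := fun X : PathSpace d => X t γ) (by
    have h : Continuous fun X : PathSpace d => X t γ :=
      (continuous_apply γ).comp (continuous_eval_const t)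
    exact h.measurable.aemeasurable)

/-- `u` is a solution, with initial data the distribution functions of `m γ`, obtained as a
large-scale limit of the multitype sticky particle dynamics: there are configurations `x n` with
`n + 1` particles of each type, nondecreasingly ordered, such that the empirical measures of the
particles of type `γ` converge weakly to `m γ`, and a subsequence along which the empirical
distributions of the sample paths converge weakly to some `μ`, such that `u γ t` is the
distribution function of the marginal of `μ`. -/
def IsLimitSolution (lam : Fin d → (Fin d → ℝ) → ℝ) (m : Fin d → ProbabilityMeasure ℝ)
    (u : Fin d → ℝ≥0 → ℝ → ℝ) : Prop :=
  ∃ x : (n : ℕ) → Config d (n + 1),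
    (∀ n γ, Monotone (x n γ)) ∧
    (∀ γ, Tendsto (fun n => empirical (x n γ)) atTop (𝓝 (m γ))) ∧
    ∃ (ℓ : ℕ → ℕ) (μ : ProbabilityMeasure (PathSpace d)),
      StrictMono ℓ ∧
      Tendsto (fun i => empirical (mspdPath lam (x (ℓ i)))) atTop (𝓝 μ) ∧
      ∀ γ t y, u γ t y = ProbabilityTheory.cdf (marginal μ γ t : Measure ℝ) y

end Limits

/-! ## Quantiles and modulus of continuity -/

/-- The pseudo-inverse of a distribution function `F`, for `v ∈ (0,1)`. -/
def quantile (F : ℝ → ℝ) (v : ℝ) : ℝ := sInf {x : ℝ | v ≤ F x}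

/-- The modulus of continuity of a bounded function `F`. -/
def modulus (F : ℝ → ℝ) (δ : ℝ) : ℝ :=
  sSup {r : ℝ | ∃ x y : ℝ, |x - y| ≤ δ ∧ r = |F x - F y|}

/-- The constant `exp ((d-1) L / c)`. -/
def spreadingConst (d : ℕ) (L c : ℝ) : ℝ := Real.exp (((d : ℝ) - 1) * (L / c))

end MSPD

end

noncomputable section

namespace MSPD

/-! ## Velocities -/

section Velocities

variable {d n : ℕ} {lam : Fin d → (Fin d → ℝ) → ℝ} {L c : ℝ}

/-! The estimate is proved for finitely many particles and then passed to the limit. Fix particles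
`i ≤ j` of the rarefaction type `γ`, at distance `D`. Because the field is nondecreasing in its own
argument, `γ:i` can be faster than `γ:j` only through the other arguments, and by the Lipschitz
bound the excess is at most `L / n` times the number of particles of other types lying between them
(`initialVelocity_sub_le_between`). By hyperbolicity each of these particles crosses the gap, always
in the direction fixed by its type, at relative speed at least `c`. So every decrease of `log D` is
paid for by progress of the crossing particles: `log D + L / (c n) * (total progress)` is
nondecreasing in time (`potential_le_potential`). The correction lies between `0` and `(d - 1) L /
c`, because there are `(d - 1) n` other particles and each crosses at most once; exponentiating
gives the constant `K` (`mspd_spreading`). This requires that type-`γ` particles travel at their own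
velocities between collisions of types. Stable blocks contain only equal velocities
(`clusterVelocity_eq`). Two separated particles do not meet either: a particle in between keeps them
apart, and without one the gap does not shrink (`typewise_rarefaction`). The potential depends on
positions only, so it survives the velocity updates (`mspd_rarefaction`). Weak convergence carries
the spreading of ordered particles to quantiles (`quantile_sub_le_of_tendsto`). Spread quantiles
bound the modulus of continuity and rule out new jumps; together with weak continuity of the
marginals in time, this yields joint continuity. -/

theorem UniformlyStrictlyHyperbolic.le_sub_of_lt (hc : UniformlyStrictlyHyperbolic lam c)
    {α β : Fin d} (hαβ : α < β) {u v : Fin d → ℝ} (hu : u ∈ Set.Icc (0 : Fin d → ℝ) 1)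
    (hv : v ∈ Set.Icc (0 : Fin d → ℝ) 1) : c ≤ lam α u - lam β v := by
  obtain ⟨b, hb⟩ := β
  induction b generalizing v with
  | zero => exact absurd hαβ (by simp [Fin.lt_def])
  | succ b ih =>
    have hb' : b < d := Nat.lt_of_succ_lt hb
    have h1 := hc.2 ⟨b, hb'⟩ ⟨b + 1, hb⟩ rfl
    rcases (Nat.lt_succ_iff.mp (Fin.lt_def.mp hαβ)).lt_or_eq with h | h
    · have h2 := ih hv hb' (Fin.lt_def.mpr h)
      have h3 := h1 v hv v hv
      linarith [hc.1]
    · have : α = ⟨b, hb'⟩ := Fin.ext h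
      rw [this]
      exact h1 u hu v hv

theorem LipschitzFields.abs_sub_zero_le (hL : LipschitzFields lam L) (γ : Fin d)
    {u : Fin d → ℝ} (hu : u ∈ Set.Icc (0 : Fin d → ℝ) 1) : |lam γ u - lam γ 0| ≤ L * d := by
  refine (hL.2 γ u hu 0 ⟨le_rfl, zero_le_one⟩).trans (mul_le_mul_of_nonneg_left ?_ hL.1)
  calc ∑ γ', |u γ' - (0 : Fin d → ℝ) γ'| ≤ ∑ _γ' : Fin d, (1 : ℝ) := by
        refine Finset.sum_le_sum fun γ' _ => ?_
        have h0 := hu.1 γ'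
        have h1 := hu.2 γ'
        simp only [Pi.zero_apply, Pi.one_apply, sub_zero] at h0 h1 ⊢
        rwa [abs_of_nonneg h0]
    _ = d := by simp

/-- Bounds on the fields which are separated by `c`. -/
theorem exists_field_bounds (hL : LipschitzFields lam L) (hc : UniformlyStrictlyHyperbolic lam c) :
    ∃ lo hi : Fin d → ℝ,
      (∀ γ, ∀ u ∈ Set.Icc (0 : Fin d → ℝ) 1, lo γ ≤ lam γ u ∧ lam γ u ≤ hi γ) ∧
      ∀ α β, α < β → hi β + c ≤ lo α := by
  have hne : (Set.Icc (0 : Fin d → ℝ) 1).Nonempty := ⟨0, le_rfl, zero_le_one⟩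
  refine ⟨fun γ => sInf (lam γ '' Set.Icc 0 1), fun γ => sSup (lam γ '' Set.Icc 0 1),
    fun γ u hu => ⟨csInf_le ⟨lam γ 0 - L * d, ?_⟩ ⟨u, hu, rfl⟩,
      le_csSup ⟨lam γ 0 + L * d, ?_⟩ ⟨u, hu, rfl⟩⟩, fun α β hαβ => ?_⟩
  · rintro _ ⟨v, hv, rfl⟩
    linarith [(abs_le.mp (hL.abs_sub_zero_le γ hv)).1]
  · rintro _ ⟨v, hv, rfl⟩
    linarith [(abs_le.mp (hL.abs_sub_zero_le γ hv)).2]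
  · refine le_csInf (hne.image _) ?_
    rintro _ ⟨u, hu, rfl⟩
    have : sSup (lam β '' Set.Icc 0 1) ≤ lam α u - c := by
      refine csSup_le (hne.image _) ?_
      rintro _ ⟨v, hv, rfl⟩
      linarith [hc.le_sub_of_lt hαβ hu hv]
    linarith

theorem mean_indicator_mem (p : Fin n → Prop) [DecidablePred p] :
    (1 / (n : ℝ)) * ∑ k' : Fin n, (if p k' then (1 : ℝ) else 0) ∈ Set.Icc (0 : ℝ) 1 := by
  have h0 : 0 ≤ ∑ k' : Fin n, (if p k' then (1 : ℝ) else 0) :=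
    Finset.sum_nonneg fun k' _ => by split_ifs <;> norm_num
  have h1 : ∑ k' : Fin n, (if p k' then (1 : ℝ) else 0) ≤ n := by
    calc _ ≤ ∑ _k' : Fin n, (1 : ℝ) :=
          Finset.sum_le_sum fun k' _ => by split_ifs <;> norm_num
      _ = n := by simp
  refine ⟨by positivity, ?_⟩
  rw [one_div, inv_mul_eq_div]
  exact div_le_one_of_le₀ h1 (Nat.cast_nonneg n)

theorem rank_mem (x : Config d n) (γ : Fin d) (k : Fin n) (γ' : Fin d) :
    rank x γ k γ' ∈ Set.Icc (0 : ℝ) 1 := by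
  unfold rank
  split_ifs
  · exact mean_indicator_mem _
  · exact mean_indicator_mem _

theorem rank_mem_cube (x : Config d n) (γ : Fin d) (k : Fin n) :
    rank x γ k ∈ Set.Icc (0 : Fin d → ℝ) 1 :=
  ⟨fun γ' => (rank_mem x γ k γ').1, fun γ' => (rank_mem x γ k γ').2⟩

theorem update_mem_cube {u : Fin d → ℝ} (hu : u ∈ Set.Icc (0 : Fin d → ℝ) 1) (γ : Fin d) {w : ℝ}
    (hw : w ∈ Set.Icc (0 : ℝ) 1) : Function.update u γ w ∈ Set.Icc (0 : Fin d → ℝ) 1 := by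
  refine ⟨fun γ' => ?_, fun γ' => ?_⟩ <;> by_cases h : γ' = γ
  · subst h; simpa using hw.1
  · simpa [h] using hu.1 γ'
  · subst h; simpa using hw.2
  · simpa [h] using hu.2 γ'

theorem sum_abs_update_sub (u v : Fin d → ℝ) (γ : Fin d) (a b : ℝ) :
    ∑ γ', |Function.update u γ a γ' - Function.update v γ b γ'| =
      |a - b| + ∑ γ' ∈ Finset.univ.erase γ, |u γ' - v γ'| := by
  rw [← Finset.add_sum_erase _ _ (Finset.mem_univ γ)]
  congr 1
  · simp
  · refine Finset.sum_congr rfl fun γ' h => ?_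
    simp [Finset.ne_of_mem_erase h]

theorem LipschitzFields.continuousOn_update (hL : LipschitzFields lam L) (γ : Fin d)
    {u : Fin d → ℝ} (hu : u ∈ Set.Icc (0 : Fin d → ℝ) 1) :
    ContinuousOn (fun w => lam γ (Function.update u γ w)) (Set.Icc 0 1) := by
  have h : LipschitzOnWith L.toNNReal (fun w => lam γ (Function.update u γ w)) (Set.Icc 0 1) := by
    refine LipschitzOnWith.of_dist_le_mul fun a ha b hb => ?_
    have := hL.2 γ _ (update_mem_cube hu γ ha) _ (update_mem_cube hu γ hb)
    rw [sum_abs_update_sub] at this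
    rw [Real.dist_eq, Real.dist_eq, Real.coe_toNNReal L hL.1]
    simpa using this
  exact h.continuousOn

theorem cell_subset (k : Fin n) {w : ℝ} (hw : w ∈ Set.Icc (0 : ℝ) (1 / n)) :
    (k : ℝ) / n + w ∈ Set.Icc (0 : ℝ) 1 := by
  have hn : (0 : ℝ) < n := by exact_mod_cast k.pos
  have hk : (k : ℝ) + 1 ≤ n := by exact_mod_cast k.isLt
  have h1 : (k : ℝ) / n + 1 / n ≤ 1 := by
    rw [← add_div]
    exact (div_le_one hn).mpr hk
  have h0 : (0 : ℝ) ≤ (k : ℝ) / n := by positivity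
  exact ⟨by linarith [hw.1], by linarith [hw.2]⟩

/-- Moving every cell to `[0, 1/n]` puts the velocities of two particles under integrals over the
same interval, so that they can be compared pointwise. -/
theorem initialVelocity_eq (x : Config d n) (γ : Fin d) (k : Fin n) :
    initialVelocity lam x γ k =
      (n : ℝ) * ∫ w in (0 : ℝ)..(1 / n), lam γ (Function.update (rank x γ k) γ ((k : ℝ) / n + w)) := by
  rw [initialVelocity,
    intervalIntegral.integral_comp_add_left (fun w => lam γ (Function.update (rank x γ k) γ w)),
    add_zero, ← add_div]

theorem intervalIntegrable_cell (hL : LipschitzFields lam L) (x : Config d n) (γ : Fin d)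
    (k i : Fin n) :
    IntervalIntegrable (fun w => lam γ (Function.update (rank x γ k) γ ((i : ℝ) / n + w)))
      volume 0 (1 / n) := by
  refine ContinuousOn.intervalIntegrable ?_
  rw [Set.uIcc_of_le (by positivity)]
  exact (hL.continuousOn_update γ (rank_mem_cube x γ k)).comp (by fun_prop)
    fun w hw => cell_subset i hw

theorem integral_cell_const (k : Fin n) (a : ℝ) :
    (n : ℝ) * ∫ _w in (0 : ℝ)..(1 / n), a = a := by
  have hn : (n : ℝ) ≠ 0 := by exact_mod_cast k.pos.ne'
  simp [mul_inv_cancel_left₀ hn]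

theorem initialVelocity_mem (hL : LipschitzFields lam L) {lo hi : Fin d → ℝ}
    (hb : ∀ γ, ∀ u ∈ Set.Icc (0 : Fin d → ℝ) 1, lo γ ≤ lam γ u ∧ lam γ u ≤ hi γ)
    (x : Config d n) (γ : Fin d) (k : Fin n) :
    lo γ ≤ initialVelocity lam x γ k ∧ initialVelocity lam x γ k ≤ hi γ := by
  have hn : (0 : ℝ) ≤ 1 / n := by positivity
  rw [initialVelocity_eq]
  constructor
  · calc lo γ = (n : ℝ) * ∫ _w in (0 : ℝ)..(1 / n), lo γ := (integral_cell_const k _).symm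
      _ ≤ _ := mul_le_mul_of_nonneg_left (intervalIntegral.integral_mono_on hn (by simp)
          (intervalIntegrable_cell hL x γ k k) fun w hw =>
            (hb γ _ (update_mem_cube (rank_mem_cube x γ k) γ (cell_subset k hw))).1)
          (Nat.cast_nonneg n)
  · calc _ ≤ (n : ℝ) * ∫ _w in (0 : ℝ)..(1 / n), hi γ :=
          mul_le_mul_of_nonneg_left (intervalIntegral.integral_mono_on hn
          (intervalIntegrable_cell hL x γ k k) (by simp) fun w hw =>
            (hb γ _ (update_mem_cube (rank_mem_cube x γ k) γ (cell_subset k hw))).2)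
          (Nat.cast_nonneg n)
      _ = hi γ := integral_cell_const k _

/-- Replacing the `γ`-th argument from the cell of `i` by the one from the cell of `j` can only
increase the field. What is left is a change of the other arguments, controlled by the Lipschitz
bound. -/
theorem initialVelocity_sub_le (hL : LipschitzFields lam L) {γ : Fin d}
    (hγ : IsRarefactionCoordinate lam γ) (x : Config d n) {i j : Fin n} (hij : i ≤ j) :
    initialVelocity lam x γ i - initialVelocity lam x γ j ≤
      L * ∑ γ' ∈ Finset.univ.erase γ, |rank x γ i γ' - rank x γ j γ'| := by
  have hn : (0 : ℝ) ≤ 1 / n := by positivity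
  set M := L * ∑ γ' ∈ Finset.univ.erase γ, |rank x γ i γ' - rank x γ j γ'|
  rw [initialVelocity_eq, initialVelocity_eq, ← mul_sub, ← intervalIntegral.integral_sub
    (intervalIntegrable_cell hL x γ i i) (intervalIntegrable_cell hL x γ j j)]
  calc _ ≤ (n : ℝ) * ∫ _w in (0 : ℝ)..(1 / n), M := by
        refine mul_le_mul_of_nonneg_left (intervalIntegral.integral_mono_on hn
          ((intervalIntegrable_cell hL x γ i i).sub (intervalIntegrable_cell hL x γ j j))
          (by simp) fun w hw => ?_) (Nat.cast_nonneg n)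
        have hi := cell_subset i hw
        have hj := cell_subset j hw
        have hle : (i : ℝ) / n + w ≤ (j : ℝ) / n + w := by
          have : (i : ℝ) ≤ j := by exact_mod_cast hij
          gcongr
        have h1 := hγ (rank x γ i) (rank_mem_cube x γ i) _ hi _ hj hle
        have h2 := hL.2 γ _ (update_mem_cube (rank_mem_cube x γ i) γ hj) _
          (update_mem_cube (rank_mem_cube x γ j) γ hj)
        rw [sum_abs_update_sub, sub_self, abs_zero, zero_add] at h2
        linarith [(abs_le.mp h2).2]
    _ = M := integral_cell_const i _

/-- The particle `p` of another type lies between `γ:i` and `γ:j`, in the sense that it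
contributes to the difference of the ranks of these two particles. -/
def IsBetween (x : Config d n) (γ : Fin d) (i j : Fin n) (p : Fin d × Fin n) : Prop :=
  (p.1 < γ ∧ x γ i ≤ x p.1 p.2 ∧ x p.1 p.2 < x γ j) ∨
    (γ < p.1 ∧ x γ i < x p.1 p.2 ∧ x p.1 p.2 ≤ x γ j)

-- Ranks are monotone in position, so the difference of the two counts has a sign and counts the
-- particles in a half-open interval. The strict and weak inequalities in `rank` decide which
-- endpoint belongs to it, as in `IsBetween`.
open scoped Classical in
theorem abs_rank_sub (x : Config d n) {γ γ' : Fin d} (hne : γ' ≠ γ) {i j : Fin n}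
    (hij : x γ i ≤ x γ j) :
    |rank x γ i γ' - rank x γ j γ'| =
      (1 / (n : ℝ)) * ∑ k, if IsBetween x γ i j (γ', k) then 1 else 0 := by
  have h0 : (0 : ℝ) ≤ (1 / (n : ℝ)) * ∑ k, if IsBetween x γ i j (γ', k) then (1 : ℝ) else 0 :=
    mul_nonneg (by positivity) (Finset.sum_nonneg fun k _ => by split_ifs <;> norm_num)
  rw [abs_sub_comm]
  rw [← abs_of_nonneg h0]
  congr 1
  unfold rank
  rcases lt_or_gt_of_ne hne with h | h
  · rw [if_pos h, if_pos h, ← mul_sub, ← Finset.sum_sub_distrib]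
    congr 1
    refine Finset.sum_congr rfl fun k _ => ?_
    simp only [orderedPairs, Finset.mem_filter, Finset.mem_univ, true_and, IsBetween, h,
      not_lt_of_gt h, false_and, or_false]
    split_ifs <;> grind
  · rw [if_neg (not_lt_of_gt h), if_neg (not_lt_of_gt h), ← mul_sub, ← Finset.sum_sub_distrib]
    congr 1
    refine Finset.sum_congr rfl fun k _ => ?_
    simp only [orderedPairs, Finset.mem_filter, Finset.mem_univ, true_and, IsBetween, h,
      not_lt_of_gt h, false_and, false_or]
    split_ifs <;> grind

open scoped Classical in
theorem initialVelocity_sub_le_between (hL : LipschitzFields lam L) {γ : Fin d}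
    (hγ : IsRarefactionCoordinate lam γ) (x : Config d n) {i j : Fin n} (hij : i ≤ j)
    (hx : x γ i ≤ x γ j) :
    initialVelocity lam x γ i - initialVelocity lam x γ j ≤
      L / n * ∑ γ' ∈ Finset.univ.erase γ, ∑ k, if IsBetween x γ i j (γ', k) then 1 else 0 := by
  refine (initialVelocity_sub_le hL hγ x hij).trans (le_of_eq ?_)
  rw [Finset.sum_congr rfl fun γ' h => abs_rank_sub x (Finset.ne_of_mem_erase h) hx,
    ← Finset.mul_sum, div_eq_mul_one_div L, mul_assoc]

theorem initialVelocity_le_of_no_between (hL : LipschitzFields lam L) {γ : Fin d}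
    (hγ : IsRarefactionCoordinate lam γ) (x : Config d n) {i j : Fin n} (hij : i ≤ j)
    (hx : x γ i ≤ x γ j) (hno : ∀ p, ¬ IsBetween x γ i j p) :
    initialVelocity lam x γ i ≤ initialVelocity lam x γ j := by
  have := initialVelocity_sub_le_between hL hγ x hij hx
  simp only [hno, if_false, Finset.sum_const_zero, mul_zero] at this
  linarith

theorem initialVelocity_le_of_eq (hL : LipschitzFields lam L) {γ : Fin d}
    (hγ : IsRarefactionCoordinate lam γ) (x : Config d n) {i j : Fin n} (hij : i ≤ j)
    (hx : x γ i = x γ j) : initialVelocity lam x γ i ≤ initialVelocity lam x γ j :=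
  initialVelocity_le_of_no_between hL hγ x hij hx.le fun p hp => by
    rcases hp with ⟨_, h1, h2⟩ | ⟨_, h1, h2⟩ <;> linarith

end Velocities

/-! ## The spreading potential -/

section Potential

/-- The fraction `a / D`, truncated to `[0,1]`. -/
def clampedRatio (a D : ℝ) : ℝ := max 0 (min 1 (a / D))

theorem clampedRatio_nonneg (a D : ℝ) : 0 ≤ clampedRatio a D := le_max_left _ _

theorem clampedRatio_le_one (a D : ℝ) : clampedRatio a D ≤ 1 :=
  max_le zero_le_one (min_le_left _ _)

/-- Read `a` as the distance covered and `D - a` as the distance left: if the first grows and the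
second shrinks, the covered fraction grows, whatever happens to `D`. -/
theorem clampedRatio_mono {a D a' D' : ℝ} (hD : 0 < D) (hD' : 0 < D') (ha : a ≤ a')
    (hb : D' - a' ≤ D - a) : clampedRatio a D ≤ clampedRatio a' D' := by
  rcases le_or_gt a 0 with h | h
  · have : clampedRatio a D = 0 :=
      max_eq_left ((min_le_right _ _).trans (div_nonpos_of_nonpos_of_nonneg h hD.le))
    rw [this]
    exact clampedRatio_nonneg _ _
  rcases le_or_gt D a with h2 | h2
  · have : clampedRatio a' D' = 1 := by
      rw [clampedRatio, min_eq_left ((one_le_div hD').mpr (by linarith)), max_eq_right zero_le_one]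
    rw [this]
    exact clampedRatio_le_one _ _
  · have : a / D ≤ a' / D' := by
      rw [div_le_div_iff₀ hD hD']
      nlinarith [mul_le_mul_of_nonneg_left hb h.le,
        mul_le_mul_of_nonneg_right ha (sub_nonneg.mpr h2.le)]
    exact max_le_max le_rfl (min_le_min le_rfl this)

/-- This is the quantitative gain when the interval shrinks and the crossing particle stays inside
it, so that truncation plays no role at the end. -/
theorem div_le_clampedRatio_sub {a D a' D' e : ℝ} (hD' : 0 < D') (hDD' : D' ≤ D) (ha : 0 ≤ a)
    (he : 0 ≤ e) (haa' : a + e ≤ a') (ha' : a' ≤ D') :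
    e / D' ≤ clampedRatio a' D' - clampedRatio a D := by
  have h1 : clampedRatio a' D' = a' / D' := by
    rw [clampedRatio, min_eq_right (div_le_one_of_le₀ ha' hD'.le),
      max_eq_right (div_nonneg (by linarith) hD'.le)]
  have h2 : clampedRatio a D ≤ a / D' :=
    (max_le (div_nonneg ha (hD'.le.trans hDD')) (min_le_right _ _)).trans
      (div_le_div_of_nonneg_left ha hD' hDD')
  have h3 : (a + e) / D' ≤ a' / D' := div_le_div_of_nonneg_right haa' hD'.le
  rw [add_div] at h3
  linarith

variable {d n : ℕ}

/-- The fraction of the way from `γ:i` to `γ:j` that has been covered by a particle of another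
type: types `γ' < γ` travel from left to right, types `γ' > γ` travel from right to left. -/
def progress (X : Config d n) (γ : Fin d) (i j : Fin n) (p : Fin d × Fin n) : ℝ :=
  clampedRatio (if p.1 < γ then X p.1 p.2 - X γ i else X γ j - X p.1 p.2) (X γ j - X γ i)

/-- The logarithm of the distance between `γ:i` and `γ:j`, corrected by the progress of the
particles of other types. -/
def potential (L c : ℝ) (γ : Fin d) (i j : Fin n) (X : Config d n) : ℝ :=
  Real.log (X γ j - X γ i) +
    L / (c * n) * ∑ γ' ∈ Finset.univ.erase γ, ∑ k, progress X γ i j (γ', k)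

theorem log_le_potential {L c : ℝ} (hL : 0 ≤ L) (hc : 0 < c) (γ : Fin d) (i j : Fin n)
    (X : Config d n) : Real.log (X γ j - X γ i) ≤ potential L c γ i j X :=
  le_add_of_nonneg_right <| mul_nonneg (by positivity) <|
    Finset.sum_nonneg fun _ _ => Finset.sum_nonneg fun _ _ => clampedRatio_nonneg _ _

theorem potential_le {L c : ℝ} (hL : 0 ≤ L) (hc : 0 < c) (γ : Fin d) (i j : Fin n)
    (X : Config d n) :
    potential L c γ i j X ≤ Real.log (X γ j - X γ i) + ((d : ℝ) - 1) * (L / c) := by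
  have hn : (0 : ℝ) < n := by exact_mod_cast i.pos
  have hd : 1 ≤ d := γ.pos
  refine add_le_add le_rfl ?_
  calc _ ≤ L / (c * n) * ∑ γ' ∈ Finset.univ.erase γ, ∑ _k : Fin n, (1 : ℝ) := by
        refine mul_le_mul_of_nonneg_left ?_ (by positivity)
        exact Finset.sum_le_sum fun _ _ => Finset.sum_le_sum fun _ _ => clampedRatio_le_one _ _
    _ = _ := by
        simp only [Finset.sum_const, Finset.card_univ, Fintype.card_fin, nsmul_eq_mul, mul_one,
          Finset.card_erase_of_mem (Finset.mem_univ γ)]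
        push_cast [hd]
        field_simp

open scoped Classical in
/-- The potential increases when `γ:i` and `γ:j` travel at constant velocities `vi` and `vj` with
`vi - vj` at most `L / n` times the number of particles of other types that travel between them. -/
theorem potential_le_potential {L c : ℝ} (hL : 0 ≤ L) (hc : 0 < c) {γ : Fin d} {i j : Fin n}
    {P Q : Config d n} {h vi vj : ℝ} (hh : 0 ≤ h) (B : Fin d × Fin n → Prop)
    (hQi : Q γ i = P γ i + h * vi) (hQj : Q γ j = P γ j + h * vj)
    (hDP : P γ i < P γ j) (hDQ : Q γ i < Q γ j)
    (hlow : ∀ p : Fin d × Fin n, p.1 < γ →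
      Q γ i - P γ i + c * h ≤ Q p.1 p.2 - P p.1 p.2 ∧ Q γ j - P γ j + c * h ≤ Q p.1 p.2 - P p.1 p.2)
    (hhigh : ∀ p : Fin d × Fin n, γ < p.1 →
      Q p.1 p.2 - P p.1 p.2 + c * h ≤ Q γ i - P γ i ∧ Q p.1 p.2 - P p.1 p.2 + c * h ≤ Q γ j - P γ j)
    (hv : vi - vj ≤ L / n * ∑ γ' ∈ Finset.univ.erase γ, ∑ k, if B (γ', k) then 1 else 0)
    (hBlow : ∀ p : Fin d × Fin n, p.1 < γ → B p → P γ i ≤ P p.1 p.2 ∧ Q p.1 p.2 ≤ Q γ j)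
    (hBhigh : ∀ p : Fin d × Fin n, γ < p.1 → B p → P p.1 p.2 ≤ P γ j ∧ Q γ i ≤ Q p.1 p.2) :
    potential L c γ i j P ≤ potential L c γ i j Q := by
  have hn : (0 : ℝ) < n := by exact_mod_cast i.pos
  have hch : 0 ≤ c * h := by positivity
  have hmono : ∀ γ' ∈ Finset.univ.erase γ, ∀ k,
      progress P γ i j (γ', k) ≤ progress Q γ i j (γ', k) := by
    intro γ' hγ' k
    unfold progress
    rcases lt_or_gt_of_ne (Finset.ne_of_mem_erase hγ') with hlt | hgt
    · obtain ⟨h1, h2⟩ := hlow (γ', k) hlt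
      rw [if_pos hlt, if_pos hlt]
      refine clampedRatio_mono (by linarith) (by linarith) ?_ ?_ <;> dsimp only at h1 h2 ⊢ <;>
        linarith
    · obtain ⟨h1, h2⟩ := hhigh (γ', k) hgt
      rw [if_neg (not_lt_of_gt hgt), if_neg (not_lt_of_gt hgt)]
      refine clampedRatio_mono (by linarith) (by linarith) ?_ ?_ <;> dsimp only at h1 h2 ⊢ <;>
        linarith
  have hDP' : 0 < P γ j - P γ i := sub_pos.mpr hDP
  have hDQ' : 0 < Q γ j - Q γ i := sub_pos.mpr hDQ
  -- If the gap does not shrink, both terms of the potential increase. Otherwise the loss in the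
  -- logarithm must be compensated by progress.
  rcases le_or_gt (P γ j - P γ i) (Q γ j - Q γ i) with hle | hlt
  · refine add_le_add (Real.log_le_log hDP' hle) (mul_le_mul_of_nonneg_left ?_ (by positivity))
    exact Finset.sum_le_sum fun γ' hγ' => Finset.sum_le_sum fun k _ => hmono γ' hγ' k
  · set D := P γ j - P γ i
    set D' := Q γ j - Q γ i
    have hD' : D - D' = h * (vi - vj) := by simp only [D, D', hQi, hQj]; ring
    have hprog : ∀ γ' ∈ Finset.univ.erase γ, ∀ k,
        c * h / D' * (if B (γ', k) then 1 else 0) ≤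
          progress Q γ i j (γ', k) - progress P γ i j (γ', k) := by
      intro γ' hγ' k
      split_ifs with hB
      · rw [mul_one]
        unfold progress
        rcases lt_or_gt_of_ne (Finset.ne_of_mem_erase hγ') with hlt' | hgt'
        · obtain ⟨h1, h2⟩ := hlow (γ', k) hlt'
          obtain ⟨h3, h4⟩ := hBlow (γ', k) hlt' hB
          rw [if_pos hlt', if_pos hlt']
          refine div_le_clampedRatio_sub hDQ' hlt.le ?_ hch ?_ ?_ <;> dsimp only at h1 h2 h3 h4 ⊢ <;>
            linarith
        · obtain ⟨h1, h2⟩ := hhigh (γ', k) hgt'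
          obtain ⟨h3, h4⟩ := hBhigh (γ', k) hgt' hB
          rw [if_neg (not_lt_of_gt hgt'), if_neg (not_lt_of_gt hgt')]
          refine div_le_clampedRatio_sub hDQ' hlt.le ?_ hch ?_ ?_ <;> dsimp only at h1 h2 h3 h4 ⊢ <;>
            linarith
      · rw [mul_zero]
        exact sub_nonneg.mpr (hmono γ' hγ' k)
    have hsum : c * h / D' *
        ∑ γ' ∈ Finset.univ.erase γ, ∑ k, (if B (γ', k) then (1 : ℝ) else 0) ≤
        ∑ γ' ∈ Finset.univ.erase γ, ∑ k, progress Q γ i j (γ', k) -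
          ∑ γ' ∈ Finset.univ.erase γ, ∑ k, progress P γ i j (γ', k) := by
      rw [Finset.mul_sum, ← Finset.sum_sub_distrib]
      refine Finset.sum_le_sum fun γ' hγ' => ?_
      rw [Finset.mul_sum, ← Finset.sum_sub_distrib]
      exact Finset.sum_le_sum fun k _ => hprog γ' hγ' k
    -- With `log r ≤ r - 1` for `r = D / D'`, the loss is measured against the final gap `D'`, the
    -- same denominator as in the gain `c * h / D'` per particle. The weight `L / (c * n)` makes the
    -- two match.
    have hlog : Real.log D - Real.log D' ≤ (D - D') / D' := by
      rw [← Real.log_div hDP'.ne' hDQ'.ne', sub_div D D' D', div_self hDQ'.ne']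
      exact Real.log_le_sub_one_of_pos (div_pos hDP' hDQ')
    set N := ∑ γ' ∈ Finset.univ.erase γ, ∑ k, (if B (γ', k) then (1 : ℝ) else 0)
    have h1 : (D - D') / D' ≤ L / (c * n) * (c * h / D' * N) := by
      have : L / (c * n) * (c * h / D' * N) = h * (L / n * N) / D' := by
        field_simp
      rw [this, hD']
      exact div_le_div_of_nonneg_right (mul_le_mul_of_nonneg_left hv hh) hDQ'.le
    have h2 := mul_le_mul_of_nonneg_left hsum (show 0 ≤ L / (c * n) by positivity)
    rw [mul_sub] at h2
    unfold potential
    linarith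

end Potential

/-! ## Sticky particle dynamics -/

section StickyFacts

variable {n : ℕ}

theorem mem_initialCluster_self (lam x : Fin n → ℝ) (k : Fin n) : k ∈ initialCluster lam x k := by
  classical
  simp only [initialCluster, Finset.mem_filter, Finset.mem_univ, true_and]
  exact ⟨k, k, ⟨le_rfl, by simp, by simp⟩, by simp, by simp⟩

theorem average_mem {lam : Fin n → ℝ} {lo hi : ℝ} (hb : ∀ i, lo ≤ lam i ∧ lam i ≤ hi)
    {s : Finset (Fin n)} (hs : s.Nonempty) : lo ≤ average lam s ∧ average lam s ≤ hi := by
  have hc : (0 : ℝ) < s.card := by exact_mod_cast hs.card_pos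
  unfold average
  rw [le_div_iff₀ hc, div_le_iff₀ hc]
  constructor
  · have := Finset.card_nsmul_le_sum s lam lo fun i _ => (hb i).1
    rw [nsmul_eq_mul] at this
    linarith
  · have := Finset.sum_le_card_nsmul s lam hi fun i _ => (hb i).2
    rw [nsmul_eq_mul] at this
    linarith

theorem clusterVelocity_mem {lam : Fin n → ℝ} {lo hi : ℝ} (hb : ∀ i, lo ≤ lam i ∧ lam i ≤ hi)
    (x : Fin n → ℝ) (k : Fin n) :
    lo ≤ clusterVelocity lam x k ∧ clusterVelocity lam x k ≤ hi :=
  average_mem hb ⟨k, mem_initialCluster_self lam x k⟩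

theorem freeFlight_zero (lam x : Fin n → ℝ) : freeFlight lam x 0 = x := by
  funext k
  simp [freeFlight]

/-- The collision time itself is included, since the restarted dynamics at time `0` returns the
configuration reached by free flight. -/
theorem sticky_of_le {lam x : Fin n → ℝ} {t : ℝ}
    (ht : t ≤ firstCollision lam x) : sticky lam x t = freeFlight lam x t := by
  rw [sticky]
  split_ifs with h2
  · have : t = firstCollision lam x := le_antisymm ht h2.2
    rw [this, sub_self, sticky_zero, afterCollision]
  · rfl

theorem sticky_of_ge {lam x : Fin n → ℝ}
    (h : numClusters lam (afterCollision lam x) < numClusters lam x) {t : ℝ}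
    (ht : firstCollision lam x ≤ t) :
    sticky lam x t = sticky lam (afterCollision lam x) (t - firstCollision lam x) := by
  rw [sticky, dif_pos ⟨h, ht⟩]

theorem sticky_of_not_lt {lam x : Fin n → ℝ}
    (h : ¬ numClusters lam (afterCollision lam x) < numClusters lam x) (t : ℝ) :
    sticky lam x t = freeFlight lam x t := by
  rw [sticky, dif_neg fun h2 => h h2.1]

theorem monotoneOn_of_restart {τ : ℝ} (hτ : 0 ≤ τ) {f : ℝ → ℝ} (h1 : MonotoneOn f (Set.Icc 0 τ))
    (h2 : MonotoneOn f (Set.Ici τ)) : MonotoneOn f (Set.Ici 0) := by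
  rw [← Set.Icc_union_Ici_eq_Ici hτ]
  exact h1.union_right h2 (isGreatest_Icc hτ) isLeast_Ici

/-- Cluster velocities are averages and so obey the same bounds as `lam`. Stating the bounds as
monotonicity makes them glue across collisions. -/
theorem sticky_displacement {lam : Fin n → ℝ} {lo hi : ℝ} (hb : ∀ i, lo ≤ lam i ∧ lam i ≤ hi)
    (x : Fin n → ℝ) (k : Fin n) :
    MonotoneOn (fun t => sticky lam x t k - lo * t) (Set.Ici 0) ∧
      MonotoneOn (fun t => hi * t - sticky lam x t k) (Set.Ici 0) := by
  induction hN : numClusters lam x using Nat.strong_induction_on generalizing x with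
  | _ N ih =>
    have hv := clusterVelocity_mem hb x k
    have hfree : ∀ s t, s ≤ t → freeFlight lam x s k - lo * s ≤ freeFlight lam x t k - lo * t ∧
        hi * s - freeFlight lam x s k ≤ hi * t - freeFlight lam x t k := by
      intro s t hst
      simp only [freeFlight]
      constructor <;> nlinarith [mul_le_mul_of_nonneg_left hv.1 (sub_nonneg.mpr hst),
        mul_le_mul_of_nonneg_left hv.2 (sub_nonneg.mpr hst)]
    by_cases h : numClusters lam (afterCollision lam x) < numClusters lam x
    · have hτ := firstCollision_nonneg lam x
      obtain ⟨ih1, ih2⟩ := ih _ (hN ▸ h) (afterCollision lam x) rfl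
      constructor
      · refine monotoneOn_of_restart hτ (fun s hs t ht hst => ?_) (fun s hs t ht hst => ?_)
        · simp only [sticky_of_le hs.2, sticky_of_le ht.2]
          exact (hfree s t hst).1
        · simp only [sticky_of_ge h hs, sticky_of_ge h ht]
          have := ih1 (a := s - firstCollision lam x) (b := t - firstCollision lam x)
            (Set.mem_Ici.mpr (sub_nonneg.mpr hs))
            (Set.mem_Ici.mpr (sub_nonneg.mpr ht)) (by linarith)
          simp only at this
          linarith
      · refine monotoneOn_of_restart hτ (fun s hs t ht hst => ?_) (fun s hs t ht hst => ?_)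
        · simp only [sticky_of_le hs.2, sticky_of_le ht.2]
          exact (hfree s t hst).2
        · simp only [sticky_of_ge h hs, sticky_of_ge h ht]
          have := ih2 (a := s - firstCollision lam x) (b := t - firstCollision lam x)
            (Set.mem_Ici.mpr (sub_nonneg.mpr hs))
            (Set.mem_Ici.mpr (sub_nonneg.mpr ht)) (by linarith)
          simp only at this
          linarith
    · simp only [sticky_of_not_lt h]
      exact ⟨fun s _ t _ hst => (hfree s t hst).1, fun s _ t _ hst => (hfree s t hst).2⟩

/-- If the velocities are nondecreasing among the particles at the same position, then a stable
block has constant velocity. -/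
theorem IsStableBlock.eq_of_mem {lam x : Fin n → ℝ}
    (hmono : ∀ i j, i ≤ j → x i = x j → lam i ≤ lam j) {a b : Fin n} (h : IsStableBlock lam x a b)
    {i : Fin n} (hi : i ∈ Finset.Icc a b) : lam i = lam a := by
  obtain ⟨hab, hx, hst⟩ := h
  have ha : a ∈ Finset.Icc a b := Finset.mem_Icc.mpr ⟨le_rfl, hab⟩
  have hb : b ∈ Finset.Icc a b := Finset.mem_Icc.mpr ⟨hab, le_rfl⟩
  have hle : ∀ j ∈ Finset.Icc a b, lam a ≤ lam j := fun j hj =>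
    hmono a j (Finset.mem_Icc.mp hj).1 (hx j hj).symm
  have hle' : lam i ≤ lam b := hmono i b (Finset.mem_Icc.mp hi).2 ((hx i hi).trans (hx b hb).symm)
  refine le_antisymm (hle'.trans ?_) (hle i hi)
  rcases hab.lt_or_eq with hlt | heq
  · by_contra! hcon
    have h1 := hst a (Finset.mem_Ico.mpr ⟨le_rfl, hlt⟩)
    have hbm : b ∈ Finset.Ioc a b := Finset.mem_Ioc.mpr ⟨hlt, le_rfl⟩
    have hc : (0 : ℝ) < (Finset.Ioc a b).card := by exact_mod_cast Finset.card_pos.mpr ⟨b, hbm⟩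
    have h2 : ∑ _j ∈ Finset.Ioc a b, lam a < ∑ j ∈ Finset.Ioc a b, lam j :=
      Finset.sum_lt_sum (fun j hj => hle j (Finset.Ioc_subset_Icc_self hj)) ⟨b, hbm, hcon⟩
    rw [Finset.sum_const, nsmul_eq_mul] at h2
    have h3 : average lam (Finset.Icc a a) = lam a := by simp [average]
    rw [h3, average, div_le_iff₀ hc] at h1
    linarith
  · rw [heq]

/-- The cluster is a union of stable blocks that all contain `k`, and each has constant velocity
`lam k`. -/
theorem clusterVelocity_eq {lam x : Fin n → ℝ}
    (hmono : ∀ i j, i ≤ j → x i = x j → lam i ≤ lam j) (k : Fin n) :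
    clusterVelocity lam x k = lam k := by
  classical
  have hne : (initialCluster lam x k).Nonempty := ⟨k, mem_initialCluster_self lam x k⟩
  have hc : (0 : ℝ) < (initialCluster lam x k).card := by exact_mod_cast hne.card_pos
  have hsum : ∑ i ∈ initialCluster lam x k, lam i = ∑ _i ∈ initialCluster lam x k, lam k := by
    refine Finset.sum_congr rfl fun i hi => ?_
    simp only [initialCluster, Finset.mem_filter, Finset.mem_univ, true_and] at hi
    obtain ⟨a, b, hab, hk, hi⟩ := hi
    rw [hab.eq_of_mem hmono hi, hab.eq_of_mem hmono hk]
  rw [clusterVelocity, average, hsum, Finset.sum_const, nsmul_eq_mul, mul_div_cancel_left₀ _ hc.ne']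

/-- A nonempty set of meeting times of finitely many pairs of trajectories that start at distinct
positions has a least element. -/
theorem sInf_meeting_mem {ι : Type*} [Finite ι] {P : ι → Prop} {f g : ι → ℝ → ℝ}
    (hf : ∀ i, Continuous (f i)) (hg : ∀ i, Continuous (g i)) (h0 : ∀ i, P i → f i 0 ≠ g i 0)
    (hne : {t : ℝ | 0 < t ∧ ∃ i, P i ∧ f i t = g i t}.Nonempty) :
    sInf {t : ℝ | 0 < t ∧ ∃ i, P i ∧ f i t = g i t} ∈
      {t : ℝ | 0 < t ∧ ∃ i, P i ∧ f i t = g i t} := by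
  have heq : {t : ℝ | 0 < t ∧ ∃ i, P i ∧ f i t = g i t} =
      Set.Ici 0 ∩ ⋃ i ∈ {i | P i}, {t | f i t = g i t} := by
    ext t
    simp only [Set.mem_ofPred_eq, Set.mem_inter_iff, Set.mem_Ici, Set.mem_iUnion, exists_prop]
    refine ⟨fun ⟨h1, h2⟩ => ⟨h1.le, h2⟩, fun ⟨h1, i, hi, h2⟩ => ⟨?_, i, hi, h2⟩⟩
    refine h1.lt_of_ne ?_
    rintro rfl
    exact h0 i hi h2
  have hcl : IsClosed {t : ℝ | 0 < t ∧ ∃ i, P i ∧ f i t = g i t} := by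
    rw [heq]
    exact isClosed_Ici.inter ((Set.toFinite _).isClosed_biUnion fun i _ =>
      isClosed_eq (hf i) (hg i))
  exact hcl.csInf_mem hne ⟨0, fun t ht => ht.1.le⟩

theorem firstCollision_spec {lam x : Fin n → ℝ} (h : firstCollision lam x ≠ 0) :
    0 < firstCollision lam x ∧
      ∃ i j, x i < x j ∧ afterCollision lam x i = afterCollision lam x j := by
  set S := {t : ℝ | 0 < t ∧ ∃ p : Fin n × Fin n, x p.1 ≠ x p.2 ∧
    freeFlight lam x t p.1 = freeFlight lam x t p.2} with hS
  have hfc : firstCollision lam x = sInf S := by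
    simp only [firstCollision, hS, Prod.exists]
  have hne : S.Nonempty := by
    rw [Set.nonempty_iff_ne_empty]
    -- The default `sInf ∅ = 0` encodes the absence of a collision.
    intro he
    rw [hfc, he, Real.sInf_empty] at h
    exact h rfl
  have hcont : ∀ i, Continuous fun t => freeFlight lam x t i := fun i =>
    (continuous_apply i).comp (continuous_freeFlight lam x)
  have hmem : sInf S ∈ S := sInf_meeting_mem
    (ι := Fin n × Fin n) (P := fun p => x p.1 ≠ x p.2) (f := fun p t => freeFlight lam x t p.1)
    (g := fun p t => freeFlight lam x t p.2) (fun p => hcont p.1) (fun p => hcont p.2)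
    (fun p hp => by simpa [freeFlight] using hp) hne
  rw [← hfc] at hmem
  obtain ⟨h1, ⟨i, j⟩, hij, h2⟩ := hmem
  refine ⟨h1, ?_⟩
  rcases lt_or_gt_of_ne hij with hlt | hgt
  · exact ⟨i, j, hlt, h2⟩
  · exact ⟨j, i, hgt, h2.symm⟩

end StickyFacts

/-! ## The typewise dynamics up to the first collision between types -/

section Typewise

variable {d n : ℕ} {lam : Fin d → (Fin d → ℝ) → ℝ} {L c : ℝ}

theorem typewise_zero (lam : Fin d → (Fin d → ℝ) → ℝ) (x : Config d n) : typewise lam x 0 = x :=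
  funext fun _ => sticky_zero _ _

theorem continuous_typewise_apply (lam : Fin d → (Fin d → ℝ) → ℝ) (x : Config d n) (γ : Fin d)
    (k : Fin n) : Continuous fun t => typewise lam x t γ k :=
  (continuous_apply k).comp ((continuous_apply γ).comp (continuous_typewise lam x))

/-- The velocity ranges of distinct types are separated by `c` uniformly over configurations, so
collisions within a type do not affect the relative speed. -/
theorem typewise_relative_displacement (hL : LipschitzFields lam L)
    (hc : UniformlyStrictlyHyperbolic lam c) (x : Config d n) {α β : Fin d} (hαβ : α < β)
    (i j : Fin n) {s t : ℝ} (hs : 0 ≤ s) (hst : s ≤ t) :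
    typewise lam x t β j - typewise lam x s β j + c * (t - s) ≤
      typewise lam x t α i - typewise lam x s α i := by
  obtain ⟨lo, hi, hb, hsep⟩ := exists_field_bounds hL hc
  have h1 := (sticky_displacement (initialVelocity_mem hL hb x α) (x α) i).1 hs (hs.trans hst) hst
  have h2 := (sticky_displacement (initialVelocity_mem hL hb x β) (x β) j).2 hs (hs.trans hst) hst
  have h3 := mul_le_mul_of_nonneg_right (hsep α β hαβ) (sub_nonneg.mpr hst)
  simp only [typewise] at h1 h2 ⊢
  linarith

/-- The times at which two particles of different types collide in the typewise dynamics. -/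
def typeCollisions (lam : Fin d → (Fin d → ℝ) → ℝ) (x : Config d n) : Set ℝ :=
  {t : ℝ | 0 < t ∧ ∃ p ∈ orderedPairs x,
    typewise lam x t p.1.1 p.1.2 = typewise lam x t p.2.1 p.2.2}

theorem mem_orderedPairs {x : Config d n} {p : (Fin d × Fin n) × (Fin d × Fin n)} :
    p ∈ orderedPairs x ↔ p.1.1 < p.2.1 ∧ x p.1.1 p.1.2 < x p.2.1 p.2.2 := by
  simp [orderedPairs]

theorem firstTypeCollision_mem {x : Config d n} (hne : (typeCollisions lam x).Nonempty) :
    firstTypeCollision lam x ∈ typeCollisions lam x :=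
  sInf_meeting_mem (P := fun p => p ∈ orderedPairs x)
    (f := fun p t => typewise lam x t p.1.1 p.1.2) (g := fun p t => typewise lam x t p.2.1 p.2.2)
    (fun _ => continuous_typewise_apply lam x _ _) (fun _ => continuous_typewise_apply lam x _ _)
    (fun p hp => by
      simp only [typewise_zero]
      exact (mem_orderedPairs.mp hp).2.ne) hne

/-- No pair can become ordered, since the lower type is faster and only gains on the higher one; the
colliding pair is lost. -/
theorem card_orderedPairs_lt (hL : LipschitzFields lam L)
    (hc : UniformlyStrictlyHyperbolic lam c) {x : Config d n}
    (hne : (typeCollisions lam x).Nonempty) :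
    (orderedPairs (afterTypeCollision lam x)).card < (orderedPairs x).card := by
  obtain ⟨hT, p, hp, hpe⟩ := firstTypeCollision_mem hne
  refine Finset.card_lt_card (Finset.ssubset_iff_of_subset ?_ |>.mpr ⟨p, hp, ?_⟩)
  · intro q hq
    rw [mem_orderedPairs] at hq ⊢
    refine ⟨hq.1, ?_⟩
    have h1 := typewise_relative_displacement hL hc x hq.1 q.1.2 q.2.2 le_rfl hT.le
    have h2 := hq.2
    have h3 := mul_pos hc.1 hT
    simp only [typewise_zero, afterTypeCollision, sub_zero] at h1 h2
    linarith
  · rw [mem_orderedPairs]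
    exact fun h => h.2.ne hpe

/-- Pairs of particles of different types remain ordered up to the first collision. -/
theorem typewise_le_of_lt {x : Config d n} {t : ℝ} (ht : 0 ≤ t)
    (hT : t ∈ lowerBounds (typeCollisions lam x)) {α β : Fin d} (hαβ : α < β) {i j : Fin n}
    (hx : x α i < x β j) : typewise lam x t α i ≤ typewise lam x t β j := by
  by_contra! hlt
  have hcont : Continuous fun t => typewise lam x t α i - typewise lam x t β j :=
    (continuous_typewise_apply lam x α i).sub (continuous_typewise_apply lam x β j)
  have h0 : (0 : ℝ) ∈ Set.Icc (typewise lam x 0 α i - typewise lam x 0 β j)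
      (typewise lam x t α i - typewise lam x t β j) := by
    rw [typewise_zero]
    exact ⟨by linarith, by linarith⟩
  obtain ⟨s, hs, hs0⟩ := intermediate_value_Icc ht hcont.continuousOn h0
  simp only at hs0
  have hspos : 0 < s := by
    refine hs.1.lt_of_ne ?_
    rintro rfl
    rw [typewise_zero] at hs0
    linarith
  have hts : t ≤ s :=
    hT ⟨hspos, ((α, i), (β, j)), mem_orderedPairs.mpr ⟨hαβ, hx⟩, sub_eq_zero.mp hs0⟩
  have : s = t := le_antisymm hs.2 hts
  rw [this] at hs0
  linarith

/-- Before a collision of types, the particle in between cannot overtake the endpoint it approaches,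
while after a positive time it is strictly separated from the other endpoint. -/
theorem typewise_lt_of_isBetween (hL : LipschitzFields lam L)
    (hc : UniformlyStrictlyHyperbolic lam c) {x : Config d n} {γ : Fin d} {i j : Fin n}
    {p : Fin d × Fin n} (hp : IsBetween x γ i j p) {t : ℝ} (ht : 0 < t)
    (hT : t ∈ lowerBounds (typeCollisions lam x)) :
    typewise lam x t γ i < typewise lam x t γ j := by
  have hct := mul_pos hc.1 ht
  rcases hp with ⟨h, h1, h2⟩ | ⟨h, h1, h2⟩
  · have h3 := typewise_le_of_lt ht.le hT h h2
    have h4 := typewise_relative_displacement hL hc x h p.2 i le_rfl ht.le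
    simp only [typewise_zero, sub_zero] at h4
    linarith
  · have h3 := typewise_le_of_lt ht.le hT h h1
    have h4 := typewise_relative_displacement hL hc x h j p.2 le_rfl ht.le
    simp only [typewise_zero, sub_zero] at h4
    linarith

/-- Up to the first collision between types, the particles of a rarefaction coordinate travel at
constant velocity. -/
theorem typewise_rarefaction (hL : LipschitzFields lam L)
    (hc : UniformlyStrictlyHyperbolic lam c) {γ : Fin d} (hγ : IsRarefactionCoordinate lam γ)
    {x : Config d n} (hx : Monotone (x γ)) {t : ℝ}
    (hT : t ∈ lowerBounds (typeCollisions lam x)) (k : Fin n) :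
    typewise lam x t γ k = x γ k + t * initialVelocity lam x γ k := by
  have hvel : ∀ k, clusterVelocity (initialVelocity lam x γ) (x γ) k = initialVelocity lam x γ k :=
    clusterVelocity_eq fun i j hij hxij => initialVelocity_le_of_eq hL hγ x hij hxij
  have hfree : ∀ s k, freeFlight (initialVelocity lam x γ) (x γ) s k =
      x γ k + s * initialVelocity lam x γ k := fun s k => by rw [freeFlight, hvel]
  rw [← hfree, typewise]
  set v := initialVelocity lam x γ
  by_cases h : numClusters v (afterCollision v (x γ)) < numClusters v (x γ)
  · rcases le_total t (firstCollision v (x γ)) with hle | hle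
    · rw [sticky_of_le hle]
    -- A collision within type `γ` no later than the first collision of types is impossible, whether
    -- or not some particle lies between the colliding ones.
    · exfalso
      have hne : firstCollision v (x γ) ≠ 0 := by
        intro h0
        rw [afterCollision, h0, freeFlight_zero] at h
        exact lt_irrefl _ h
      obtain ⟨hpos, i, j, hij, heq⟩ := firstCollision_spec hne
      have hτ : firstCollision v (x γ) ∈ lowerBounds (typeCollisions lam x) :=
        fun s hs => hle.trans (hT hs)
      by_cases hb : ∃ p, IsBetween x γ i j p
      · obtain ⟨p, hp⟩ := hb
        have h1 := typewise_lt_of_isBetween hL hc hp hpos hτ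
        change sticky v (x γ) _ i < sticky v (x γ) _ j at h1
        rw [sticky_of_le le_rfl] at h1
        exact h1.ne heq
      · have hij' : i ≤ j := (hx.reflect_lt hij).le
        have h1 : v i ≤ v j := initialVelocity_le_of_no_between hL hγ x hij' hij.le
          (not_exists.mp hb)
        have h2 := mul_le_mul_of_nonneg_left h1 hpos.le
        rw [afterCollision, hfree, hfree] at heq
        linarith
  · rw [sticky_of_not_lt h]

theorem monotone_typewise (hL : LipschitzFields lam L)
    (hc : UniformlyStrictlyHyperbolic lam c) {γ : Fin d} (hγ : IsRarefactionCoordinate lam γ)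
    {x : Config d n} (hx : Monotone (x γ)) {t : ℝ} (ht : 0 ≤ t)
    (hT : t ∈ lowerBounds (typeCollisions lam x)) : Monotone (typewise lam x t γ) := by
  intro i j hij
  rcases ht.eq_or_lt with rfl | hpos
  · rw [typewise_zero]
    exact hx hij
  by_cases hb : ∃ p, IsBetween x γ i j p
  · obtain ⟨p, hp⟩ := hb
    exact (typewise_lt_of_isBetween hL hc hp hpos hT).le
  · have h1 := initialVelocity_le_of_no_between hL hγ x hij (hx hij) (not_exists.mp hb)
    rw [typewise_rarefaction hL hc hγ hx hT, typewise_rarefaction hL hc hγ hx hT]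
    have := hx hij
    gcongr

/-- The velocities were fixed at time `0`, so the particles that count are those between `i` and `j`
at time `0`, even though the potential is compared between `s` and `t`. They are still inside the
gap throughout, since no collision of types occurs before `t`. -/
theorem typewise_potential (hL : LipschitzFields lam L)
    (hc : UniformlyStrictlyHyperbolic lam c) {γ : Fin d} (hγ : IsRarefactionCoordinate lam γ)
    {x : Config d n} (hx : Monotone (x γ)) {s t : ℝ} (hs : 0 ≤ s) (hst : s ≤ t)
    (hT : t ∈ lowerBounds (typeCollisions lam x)) {i j : Fin n} (hij : i ≤ j)
    (hD : typewise lam x s γ i < typewise lam x s γ j) :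
    typewise lam x t γ i < typewise lam x t γ j ∧
      potential L c γ i j (typewise lam x s) ≤ potential L c γ i j (typewise lam x t) := by
  have hS : s ∈ lowerBounds (typeCollisions lam x) := fun r hr => hst.trans (hT hr)
  have hdisp : ∀ k, typewise lam x t γ k =
      typewise lam x s γ k + (t - s) * initialVelocity lam x γ k := fun k => by
    rw [typewise_rarefaction hL hc hγ hx hT, typewise_rarefaction hL hc hγ hx hS]
    ring
  have hDt : typewise lam x t γ i < typewise lam x t γ j := by
    rcases (hs.trans hst).eq_or_lt with h0 | hpos
    · rwa [show t = s by linarith]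
    by_cases hb : ∃ p, IsBetween x γ i j p
    · obtain ⟨p, hp⟩ := hb
      exact typewise_lt_of_isBetween hL hc hp hpos hT
    · have h1 := initialVelocity_le_of_no_between hL hγ x hij (hx hij) (not_exists.mp hb)
      have h2 := mul_le_mul_of_nonneg_left h1 (sub_nonneg.mpr hst)
      rw [hdisp, hdisp]
      linarith
  refine ⟨hDt, potential_le_potential hL.1 hc.1 (sub_nonneg.mpr hst) (IsBetween x γ i j)
    (hdisp i) (hdisp j) hD hDt (fun p hp => ?_) (fun p hp => ?_)
    (initialVelocity_sub_le_between hL hγ x hij (hx hij)) (fun p hp hB => ?_) (fun p hp hB => ?_)⟩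
  · exact ⟨typewise_relative_displacement hL hc x hp p.2 i hs hst,
      typewise_relative_displacement hL hc x hp p.2 j hs hst⟩
  · exact ⟨typewise_relative_displacement hL hc x hp i p.2 hs hst,
      typewise_relative_displacement hL hc x hp j p.2 hs hst⟩
  · rcases hB with ⟨_, h1, h2⟩ | ⟨h0, _, _⟩
    · refine ⟨?_, typewise_le_of_lt (hs.trans hst) hT hp h2⟩
      have h3 := typewise_relative_displacement hL hc x hp p.2 i le_rfl hs
      have h4 := mul_nonneg hc.1.le hs
      simp only [typewise_zero, sub_zero] at h3
      linarith
    · exact absurd h0 (not_lt_of_gt hp)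
  · rcases hB with ⟨h0, _, _⟩ | ⟨_, h1, h2⟩
    · exact absurd h0 (not_lt_of_gt hp)
    · refine ⟨?_, typewise_le_of_lt (hs.trans hst) hT hp h1⟩
      have h3 := typewise_relative_displacement hL hc x hp j p.2 le_rfl hs
      have h4 := mul_nonneg hc.1.le hs
      simp only [typewise_zero, sub_zero] at h3
      linarith

end Typewise

/-! ## The multitype dynamics -/

section Multitype

variable {d n : ℕ} {lam : Fin d → (Fin d → ℝ) → ℝ} {L c : ℝ}

theorem mspd_of_le {x : Config d n} {t : ℝ}
    (ht : t ≤ firstTypeCollision lam x) : mspd lam x t = typewise lam x t := by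
  rw [mspd]
  split_ifs with h2
  · have : t = firstTypeCollision lam x := le_antisymm ht h2.2
    rw [this, sub_self, mspd_zero, afterTypeCollision]
  · rfl

theorem mspd_of_ge {x : Config d n}
    (h : (orderedPairs (afterTypeCollision lam x)).card < (orderedPairs x).card) {t : ℝ}
    (ht : firstTypeCollision lam x ≤ t) :
    mspd lam x t = mspd lam (afterTypeCollision lam x) (t - firstTypeCollision lam x) := by
  rw [mspd, dif_pos ⟨h, ht⟩]

theorem mspd_of_not_lt {x : Config d n}
    (h : ¬ (orderedPairs (afterTypeCollision lam x)).card < (orderedPairs x).card) (t : ℝ) :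
    mspd lam x t = typewise lam x t := by
  rw [mspd, dif_neg fun h2 => h h2.1]

theorem firstTypeCollision_nonneg (lam : Fin d → (Fin d → ℝ) → ℝ) (x : Config d n) :
    0 ≤ firstTypeCollision lam x := Real.sInf_nonneg fun _ ht => ht.1.le

theorem mem_lowerBounds_of_le {x : Config d n} {t : ℝ} (ht : t ≤ firstTypeCollision lam x) :
    t ∈ lowerBounds (typeCollisions lam x) :=
  fun _ hs => ht.trans (csInf_le ⟨0, fun _ hr => hr.1.le⟩ hs)

/-- The particles of a rarefaction coordinate remain ordered and do not meet once they have
distinct positions, and the potential increases. -/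
theorem mspd_rarefaction (hL : LipschitzFields lam L)
    (hc : UniformlyStrictlyHyperbolic lam c) {γ : Fin d} (hγ : IsRarefactionCoordinate lam γ)
    {x : Config d n} (hx : Monotone (x γ)) :
    (∀ t, 0 ≤ t → Monotone (mspd lam x t γ)) ∧
      ∀ i j, i ≤ j → ∀ s t, 0 ≤ s → s ≤ t → mspd lam x s γ i < mspd lam x s γ j →
        mspd lam x t γ i < mspd lam x t γ j ∧
          potential L c γ i j (mspd lam x s) ≤ potential L c γ i j (mspd lam x t) := by
  induction hN : (orderedPairs x).card using Nat.strong_induction_on generalizing x with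
  | _ N ih =>
    by_cases h : (orderedPairs (afterTypeCollision lam x)).card < (orderedPairs x).card
    · have hT := firstTypeCollision_nonneg lam x
      have hlow : ∀ t ≤ firstTypeCollision lam x, t ∈ lowerBounds (typeCollisions lam x) :=
        fun t ht => mem_lowerBounds_of_le ht
      obtain ⟨ih1, ih2⟩ := ih _ (hN ▸ h) (x := afterTypeCollision lam x)
        (monotone_typewise hL hc hγ hx hT (hlow _ le_rfl)) rfl
      constructor
      · intro t ht
        rcases le_total t (firstTypeCollision lam x) with hle | hle
        · rw [mspd_of_le hle]
          exact monotone_typewise hL hc hγ hx ht (hlow t hle)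
        · rw [mspd_of_ge h hle]
          exact ih1 _ (sub_nonneg.mpr hle)
      · intro i j hij s t hs hst hD
        have key1 : ∀ r, s ≤ r → r ≤ firstTypeCollision lam x →
            mspd lam x r γ i < mspd lam x r γ j ∧
              potential L c γ i j (mspd lam x s) ≤ potential L c γ i j (mspd lam x r) := by
          intro r hsr hr
          rw [mspd_of_le (hsr.trans hr)] at hD ⊢
          rw [mspd_of_le hr]
          exact typewise_potential hL hc hγ hx hs hsr (hlow r hr) hij hD
        have key2 : ∀ r, firstTypeCollision lam x ≤ r → r ≤ t →
            mspd lam x r γ i < mspd lam x r γ j → mspd lam x t γ i < mspd lam x t γ j ∧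
              potential L c γ i j (mspd lam x r) ≤ potential L c γ i j (mspd lam x t) := by
          intro r hr hrt hD
          rw [mspd_of_ge h hr] at hD ⊢
          rw [mspd_of_ge h (hr.trans hrt)]
          exact ih2 i j hij _ _ (sub_nonneg.mpr hr) (by linarith) hD
        rcases le_total t (firstTypeCollision lam x) with hle | hle
        · exact key1 t hst hle
        · rcases le_total s (firstTypeCollision lam x) with hle' | hle'
          · obtain ⟨h1, h2⟩ := key1 _ hle' le_rfl
            obtain ⟨h3, h4⟩ := key2 _ le_rfl hle h1
            exact ⟨h3, h2.trans h4⟩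
          · exact key2 s hle' hst hD
    -- If the number of ordered pairs does not drop, there is no collision of types at all, and the
    -- typewise estimates hold for all times.
    · have hlow : ∀ t, t ∈ lowerBounds (typeCollisions lam x) := fun t s hs =>
        absurd (card_orderedPairs_lt hL hc ⟨s, hs⟩) h
      simp only [mspd_of_not_lt h]
      exact ⟨fun t ht => monotone_typewise hL hc hγ hx ht (hlow t),
        fun i j hij s t hs hst hD => typewise_potential hL hc hγ hx hs hst (hlow t) hij hD⟩

theorem mspd_spreading (hL : LipschitzFields lam L)
    (hc : UniformlyStrictlyHyperbolic lam c) {γ : Fin d} (hγ : IsRarefactionCoordinate lam γ)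
    {x : Config d n} (hx : Monotone (x γ)) {i j : Fin n} (hij : i ≤ j) {s t : ℝ} (hs : 0 ≤ s)
    (hst : s ≤ t) :
    mspd lam x s γ j - mspd lam x s γ i ≤
      spreadingConst d L c * (mspd lam x t γ j - mspd lam x t γ i) := by
  obtain ⟨h1, h2⟩ := mspd_rarefaction hL hc hγ hx
  have hK : 0 < spreadingConst d L c := Real.exp_pos _
  rcases (h1 s hs hij).eq_or_lt with heq | hlt
  · rw [heq, sub_self]
    exact mul_nonneg hK.le (sub_nonneg.mpr (h1 t (hs.trans hst) hij))
  · obtain ⟨h3, h4⟩ := h2 i j hij s t hs hst hlt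
    have h5 := (log_le_potential hL.1 hc.1 γ i j (mspd lam x s)).trans
      (h4.trans (potential_le hL.1 hc.1 γ i j (mspd lam x t)))
    have h6 := Real.exp_le_exp.mpr h5
    rw [Real.exp_log (sub_pos.mpr hlt), Real.exp_add, Real.exp_log (sub_pos.mpr h3)] at h6
    rw [spreadingConst, mul_comm]
    exact h6

end Multitype

/-! ## Distribution functions, quantiles and weak convergence -/

section Quantiles

open ProbabilityTheory

/-- The infimum is finite for levels in `(0,1)` and attained by right continuity, which gives the
Galois connection. -/
theorem quantile_le_iff (μ : ProbabilityMeasure ℝ) {v : ℝ} (hv : v ∈ Set.Ioo (0 : ℝ) 1) {y : ℝ} :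
    quantile (cdf (μ : Measure ℝ)) v ≤ y ↔ v ≤ cdf (μ : Measure ℝ) y := by
  set F := cdf (μ : Measure ℝ) with hF
  have hne : {x : ℝ | v ≤ F x}.Nonempty :=
    (((tendsto_cdf_atTop (μ : Measure ℝ)).eventually_const_lt hv.2).exists).imp fun _ h => h.le
  have hbdd : BddBelow {x : ℝ | v ≤ F x} := by
    obtain ⟨b, hb⟩ := ((tendsto_cdf_atBot (μ : Measure ℝ)).eventually_lt_const hv.1).exists
    refine ⟨b, fun x hx => ?_⟩
    by_contra! hlt
    exact absurd (hx.trans (monotone_cdf _ hlt.le)) (not_le.mpr hb)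
  refine ⟨fun h => ?_, fun h => csInf_le hbdd h⟩
  refine le_trans ?_ (monotone_cdf (μ : Measure ℝ) h)
  have hlim : Tendsto F (𝓝[>] (quantile F v)) (𝓝 (F (quantile F v))) :=
    (F.right_continuous _).mono_left (nhdsWithin_mono _ Set.Ioi_subset_Ici_self)
  refine ge_of_tendsto hlim ?_
  filter_upwards [self_mem_nhdsWithin] with z hz
  obtain ⟨w, hw, hwz⟩ := exists_lt_of_csInf_lt hne hz
  exact le_trans hw (monotone_cdf _ hwz.le)

theorem lt_quantile_iff (μ : ProbabilityMeasure ℝ) {v : ℝ} (hv : v ∈ Set.Ioo (0 : ℝ) 1) {y : ℝ} :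
    y < quantile (cdf (μ : Measure ℝ)) v ↔ cdf (μ : Measure ℝ) y < v := by
  rw [← not_le, quantile_le_iff μ hv, not_le]

variable {ι : Type*} {l : Filter ι}

theorem eventually_cdf_lt {μs : ι → ProbabilityMeasure ℝ} {μ : ProbabilityMeasure ℝ}
    (h : Tendsto μs l (𝓝 μ)) {a x : ℝ} (hx : cdf (μ : Measure ℝ) x < a) :
    ∀ᶠ i in l, cdf (μs i : Measure ℝ) x < a := by
  have ha : 0 < a := (cdf_nonneg _ _).trans_lt hx
  have h1 := ProbabilityMeasure.limsup_measure_closed_le_of_tendsto h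
    (isClosed_Iic : IsClosed (Set.Iic x))
  have h2 : (μ : Measure ℝ) (Set.Iic x) < ENNReal.ofReal a := by
    rw [← ofReal_cdf]
    exact (ENNReal.ofReal_lt_ofReal_iff ha).mpr hx
  filter_upwards [eventually_lt_of_limsup_lt (h1.trans_lt h2)] with i hi
  rw [← ofReal_cdf] at hi
  exact (ENNReal.ofReal_lt_ofReal_iff ha).mp hi

/-- The portmanteau lower bound needs an open set, hence the shift from `x` to a larger `y`; the
upper bound on closed half-lines needs no shift. -/
theorem eventually_lt_cdf {μs : ι → ProbabilityMeasure ℝ} {μ : ProbabilityMeasure ℝ}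
    (h : Tendsto μs l (𝓝 μ)) {a x y : ℝ} (hx : a < cdf (μ : Measure ℝ) x) (hxy : x < y) :
    ∀ᶠ i in l, a < cdf (μs i : Measure ℝ) y := by
  rcases lt_or_ge a 0 with ha | ha
  · exact Eventually.of_forall fun i => ha.trans_le (cdf_nonneg _ _)
  have h1 := ProbabilityMeasure.le_liminf_measure_open_of_tendsto h
    (isOpen_Iio : IsOpen (Set.Iio y))
  have h2 : ENNReal.ofReal a < (μ : Measure ℝ) (Set.Iio y) := by
    refine lt_of_lt_of_le ?_ (measure_mono (Set.Iic_subset_Iio.mpr hxy))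
    rw [← ofReal_cdf]
    exact (ENNReal.ofReal_lt_ofReal_iff (ha.trans_lt hx)).mpr hx
  filter_upwards [eventually_lt_of_lt_liminf (h2.trans_le h1)] with i hi
  have h3 := hi.trans_le (measure_mono Set.Iio_subset_Iic_self)
  rw [← ofReal_cdf] at h3
  exact (ENNReal.ofReal_lt_ofReal_iff_of_nonneg ha).mp h3

end Quantiles

/-! ### Order statistics of empirical measures and their limits -/

section Empirical

open ProbabilityTheory

variable {n : ℕ} [NeZero n]

open scoped Classical in
theorem cdf_empirical (f : Fin n → ℝ) (y : ℝ) :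
    cdf (empirical f : Measure ℝ) y = ((Finset.univ.filter fun k => f k ≤ y).card : ℝ) / n := by
  rw [cdf_eq_real, measureReal_def]
  have : (empirical f : Measure ℝ) (Set.Iic y) =
      (n : ℝ≥0∞)⁻¹ * ((Finset.univ.filter fun k => f k ≤ y).card : ℝ≥0∞) := by
    simp only [empirical, ProbabilityMeasure.coe_mk, Measure.smul_apply, Measure.coe_finsetSum,
      Finset.sum_apply, Measure.dirac_apply' _ measurableSet_Iic, smul_eq_mul]
    simp [Set.indicator_apply, Finset.sum_boole]
  rw [this, ENNReal.toReal_mul, ENNReal.toReal_inv, ENNReal.toReal_natCast, ENNReal.toReal_natCast,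
    inv_mul_eq_div]

/-- Indices start at `0`: more than `k` particles are at or below `y`, hence so are the first `k +
1` of them. -/
theorem le_of_lt_cdf_empirical {f : Fin n → ℝ} (hf : Monotone f) {k : Fin n} {v y : ℝ}
    (hk : (k : ℝ) ≤ v * n) (hv : v < cdf (empirical f : Measure ℝ) y) : f k ≤ y := by
  classical
  have hn : (0 : ℝ) < n := by exact_mod_cast k.pos
  by_contra! hlt
  have hsub : (Finset.univ.filter fun j => f j ≤ y) ⊆ Finset.Iio k := fun j hj => by
    rw [Finset.mem_filter] at hj
    exact Finset.mem_Iio.mpr (hf.reflect_lt (hj.2.trans_lt hlt))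
  have hcard : (((Finset.univ.filter fun j => f j ≤ y).card : ℕ) : ℝ) ≤ k := by
    exact_mod_cast (Finset.card_le_card hsub).trans_eq (Fin.card_Iio k)
  rw [cdf_empirical, lt_div_iff₀ hn] at hv
  linarith

theorem lt_of_cdf_empirical_lt {f : Fin n → ℝ} (hf : Monotone f) {k : Fin n} {v y : ℝ}
    (hk : v * n < (k : ℝ) + 1) (hv : cdf (empirical f : Measure ℝ) y < v) : y < f k := by
  classical
  have hn : (0 : ℝ) < n := by exact_mod_cast k.pos
  by_contra! hle
  have hsub : Finset.Iic k ⊆ (Finset.univ.filter fun j => f j ≤ y) := fun j hj =>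
    Finset.mem_filter.mpr ⟨Finset.mem_univ j, (hf (Finset.mem_Iic.mp hj)).trans hle⟩
  have hcard : (k : ℝ) + 1 ≤ ((Finset.univ.filter fun j => f j ≤ y).card : ℕ) := by
    exact_mod_cast (Fin.card_Iic k).symm.trans_le (Finset.card_le_card hsub)
  rw [cdf_empirical, div_lt_iff₀ hn] at hv
  exact absurd (hv.trans hk) (not_lt.mpr hcard)

theorem exists_floor_index {v : ℝ} (hv : v ∈ Set.Ioo (0 : ℝ) 1) :
    ∃ k : Fin n, (k : ℕ) = ⌊v * n⌋₊ ∧ (k : ℝ) ≤ v * n ∧ v * n < (k : ℝ) + 1 := by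
  have hn : (0 : ℝ) < n := by exact_mod_cast Nat.pos_of_ne_zero (NeZero.ne n)
  have h0 : 0 ≤ v * n := mul_nonneg hv.1.le hn.le
  exact ⟨⟨⌊v * n⌋₊, (Nat.floor_lt h0).mpr (by nlinarith [hv.2])⟩, rfl, Nat.floor_le h0,
    Nat.lt_floor_add_one _⟩

theorem empirical_map {E E' : Type*} [MeasurableSpace E] [MeasurableSpace E'] (f : Fin n → E)
    {g : E → E'} (hg : Measurable g) (hg' : AEMeasurable g (empirical f : Measure E)) :
    (empirical f).map hg' = empirical (g ∘ f) := by
  apply Subtype.ext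
  ext s hs
  change (Measure.map g ((n : ℝ≥0∞)⁻¹ • ∑ k, Measure.dirac (f k))) s =
    ((n : ℝ≥0∞)⁻¹ • ∑ k, Measure.dirac ((g ∘ f) k)) s
  rw [Measure.map_apply hg hs]
  simp only [Measure.smul_apply, Measure.coe_finsetSum, Finset.sum_apply,
    Measure.dirac_apply' _ hs, Measure.dirac_apply' _ (hg hs)]
  rfl

/-- A spreading estimate between two families of ordered configurations passes to the quantiles of
the weak limits of their empirical measures. -/
theorem quantile_sub_le_of_tendsto {ι : Type*} {l : Filter ι} [l.NeBot] {N : ι → ℕ}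
    {f g : ∀ i, Fin (N i + 1) → ℝ} (hf : ∀ i, Monotone (f i)) (hg : ∀ i, Monotone (g i)) {K : ℝ}
    (hK : 0 ≤ K) (hfg : ∀ i, ∀ j k, j ≤ k → f i k - f i j ≤ K * (g i k - g i j))
    {μ ν : ProbabilityMeasure ℝ} (hμ : Tendsto (fun i => empirical (f i)) l (𝓝 μ))
    (hν : Tendsto (fun i => empirical (g i)) l (𝓝 ν)) {v₁ v₂ : ℝ} (hv₁ : v₁ ∈ Set.Ioo (0 : ℝ) 1)
    (hv₂ : v₂ ∈ Set.Ioo (0 : ℝ) 1) (hv : v₁ ≤ v₂) :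
    quantile (cdf (μ : Measure ℝ)) v₂ - quantile (cdf (μ : Measure ℝ)) v₁ ≤
      K * (quantile (cdf (ν : Measure ℝ)) v₂ - quantile (cdf (ν : Measure ℝ)) v₁) := by
  rcases hv.eq_or_lt with rfl | hlt
  · simp
  set F := cdf (μ : Measure ℝ)
  set G := cdf (ν : Measure ℝ)
  refine le_of_forall_pos_le_add fun η hη => ?_
  -- Each of the four quantiles is located up to `ε`; the two of `ν` enter with the factor `K`.
  obtain ⟨ε, hε, hεη⟩ : ∃ ε > 0, (2 + 2 * K) * ε = η :=
    ⟨η / (2 + 2 * K), by positivity, by field_simp⟩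
  have ha₁ : v₁ ≤ F (quantile F v₁) := (quantile_le_iff μ hv₁).mp le_rfl
  have hb₂ : v₂ ≤ G (quantile G v₂) := (quantile_le_iff ν hv₂).mp le_rfl
  have hb₁ : G (quantile G v₁ - ε) < v₁ := (lt_quantile_iff ν hv₁).mp (by linarith)
  have ha₂ : F (quantile F v₂ - ε) < v₂ := (lt_quantile_iff μ hv₂).mp (by linarith)
  -- The levels `w₁ < v₁ < w₂ < v₂` leave strict room in all four inequalities, so each survives
  -- approximation by empirical measures.
  obtain ⟨w₁, hw₁, hw₁'⟩ := exists_between hb₁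
  obtain ⟨w₂, hw₂, hw₂'⟩ := exists_between (max_lt ha₂ hlt)
  have hw₁0 : 0 < w₁ := (cdf_nonneg _ _).trans_lt hw₁
  have hw₁w₂ : w₁ < w₂ := hw₁'.trans ((le_max_right _ _).trans_lt hw₂)
  have e1 := eventually_lt_cdf hμ (hw₁'.trans_le ha₁) (show quantile F v₁ < quantile F v₁ + ε by
    linarith)
  have e2 := eventually_lt_cdf hν (hw₂'.trans_le hb₂) (show quantile G v₂ < quantile G v₂ + ε by
    linarith)
  have e3 := eventually_cdf_lt hν hw₁
  have e4 := eventually_cdf_lt hμ ((le_max_left _ _).trans_lt hw₂)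
  obtain ⟨i, h1, h2, h3, h4⟩ := (e1.and (e2.and (e3.and e4))).exists
  obtain ⟨k₁, hk₁, hk₁', hk₁''⟩ := exists_floor_index (n := N i + 1) (v := w₁)
    ⟨hw₁0, hw₁'.trans hv₁.2⟩
  obtain ⟨k₂, hk₂, hk₂', hk₂''⟩ := exists_floor_index (n := N i + 1) (v := w₂)
    ⟨hw₁0.trans hw₁w₂, hw₂'.trans hv₂.2⟩
  have hk : k₁ ≤ k₂ := by
    rw [Fin.le_def, hk₁, hk₂]
    exact Nat.floor_le_floor (mul_le_mul_of_nonneg_right hw₁w₂.le (Nat.cast_nonneg _))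
  have h1' := le_of_lt_cdf_empirical (hf i) hk₁' h1
  have h2' := le_of_lt_cdf_empirical (hg i) hk₂' h2
  have h3' := lt_of_cdf_empirical_lt (hg i) hk₁'' h3
  have h4' := lt_of_cdf_empirical_lt (hf i) hk₂'' h4
  have h5 := mul_le_mul_of_nonneg_left (show g i k₂ - g i k₁ ≤
    (quantile G v₂ + ε) - (quantile G v₁ - ε) by linarith) hK
  have h6 := hfg i k₁ k₂ hk
  linarith

end Empirical

/-! ## Consequences of the spreading of quantiles -/

section Spreading

open ProbabilityTheory

variable {μ ν : ProbabilityMeasure ℝ} {K : ℝ}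

theorem modulus_cdf_le (hK : 0 < K)
    (hμν : ∀ v₁ ∈ Set.Ioo (0 : ℝ) 1, ∀ v₂ ∈ Set.Ioo (0 : ℝ) 1, v₁ ≤ v₂ →
      quantile (cdf (μ : Measure ℝ)) v₂ - quantile (cdf (μ : Measure ℝ)) v₁ ≤
        K * (quantile (cdf (ν : Measure ℝ)) v₂ - quantile (cdf (ν : Measure ℝ)) v₁))
    {δ : ℝ} (hδ : 0 ≤ δ) :
    modulus (cdf (ν : Measure ℝ)) δ ≤ modulus (cdf (μ : Measure ℝ)) (K * δ) := by
  set F := cdf (μ : Measure ℝ)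
  set G := cdf (ν : Measure ℝ)
  set M := modulus F (K * δ)
  have hM : ∀ x y, |x - y| ≤ K * δ → |F x - F y| ≤ M := by
    intro x y hxy
    refine le_csSup ⟨1, ?_⟩ ⟨x, y, hxy, rfl⟩
    rintro _ ⟨a, b, _, rfl⟩
    rw [abs_le]
    constructor <;> linarith [cdf_nonneg (μ : Measure ℝ) a, cdf_nonneg (μ : Measure ℝ) b,
      cdf_le_one (μ : Measure ℝ) a, cdf_le_one (μ : Measure ℝ) b]
  have hM0 : 0 ≤ M := (abs_nonneg _).trans (hM 0 0 (by simpa using mul_nonneg hK.le hδ))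
  have key : ∀ x y, x ≤ y → y - x ≤ δ → G y - G x ≤ M := by
    intro x y hxy hδ'
    by_contra! hlt
    -- The excess over `M` is cut into three: the levels `G x + η` and `G y - η` still differ by `M
    -- + η`. Their `μ`-quantiles are less than `K * δ` apart, so `F` would rise by more than `M`
    -- over a distance `K * δ`.
    obtain ⟨η, hη, hηe⟩ : ∃ η > 0, 3 * η = G y - G x - M :=
      ⟨(G y - G x - M) / 3, by linarith, by ring⟩
    have hx0 := cdf_nonneg (ν : Measure ℝ) x
    have hy1 := cdf_le_one (ν : Measure ℝ) y
    have hw₁ : G x + η ∈ Set.Ioo (0 : ℝ) 1 := ⟨by linarith, by linarith⟩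
    have hw₂ : G y - η ∈ Set.Ioo (0 : ℝ) 1 := ⟨by linarith, by linarith⟩
    have h1 := hμν _ hw₁ _ hw₂ (by linarith)
    have h2 : x < quantile G (G x + η) := (lt_quantile_iff ν hw₁).mpr (by linarith)
    have h3 : quantile G (G y - η) ≤ y := (quantile_le_iff ν hw₂).mpr (by linarith)
    have h4 : K * (quantile G (G y - η) - quantile G (G x + η)) < K * δ :=
      mul_lt_mul_of_pos_left (by linarith) hK
    have h5 : F (quantile F (G y - η) - K * δ) < G x + η :=
      (lt_quantile_iff μ hw₁).mp (by linarith)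
    have h6 : G y - η ≤ F (quantile F (G y - η)) := (quantile_le_iff μ hw₂).mp le_rfl
    have h7 := (le_abs_self _).trans (hM (quantile F (G y - η)) (quantile F (G y - η) - K * δ)
      (by rw [sub_sub_cancel, abs_of_nonneg (mul_nonneg hK.le hδ)]))
    linarith
  refine csSup_le ⟨0, 0, 0, by simpa using hδ, by simp⟩ ?_
  rintro _ ⟨x, y, hxy, rfl⟩
  have hxy' := abs_le.mp hxy
  rcases le_total x y with h | h
  · rw [abs_sub_comm, abs_of_nonneg (sub_nonneg.mpr (monotone_cdf _ h))]
    exact key x y h (by linarith)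
  · rw [abs_of_nonneg (sub_nonneg.mpr (monotone_cdf _ h))]
    exact key y x h (by linarith)

/-- The distribution function with spread out quantiles has no jumps. -/
theorem exists_lt_cdf_of_continuous
    (hμν : ∀ v₁ ∈ Set.Ioo (0 : ℝ) 1, ∀ v₂ ∈ Set.Ioo (0 : ℝ) 1, v₁ ≤ v₂ →
      quantile (cdf (μ : Measure ℝ)) v₂ - quantile (cdf (μ : Measure ℝ)) v₁ ≤
        K * (quantile (cdf (ν : Measure ℝ)) v₂ - quantile (cdf (ν : Measure ℝ)) v₁))
    (hcont : Continuous (cdf (μ : Measure ℝ))) {x a : ℝ} (ha : a < cdf (ν : Measure ℝ) x) :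
    ∃ y < x, a < cdf (ν : Measure ℝ) y := by
  set F := cdf (μ : Measure ℝ)
  set G := cdf (ν : Measure ℝ)
  rcases lt_or_ge a 0 with ha0 | ha0
  · exact ⟨x - 1, by linarith, ha0.trans_le (cdf_nonneg _ _)⟩
  by_contra! hno
  obtain ⟨w₂, hw₂, hw₂'⟩ := exists_between ha
  obtain ⟨w₁, hw₁, hw₁'⟩ := exists_between hw₂
  have hx1 := cdf_le_one (ν : Measure ℝ) x
  have m₁ : w₁ ∈ Set.Ioo (0 : ℝ) 1 := ⟨by linarith, by linarith⟩
  have m₂ : w₂ ∈ Set.Ioo (0 : ℝ) 1 := ⟨by linarith, by linarith⟩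
  -- A jump of `G` at `x` sends all levels inside it to the single quantile `x`. The `μ`-quantiles
  -- of `w₁` and `w₂` then coincide, so that `F` would jump as well.
  have hq : ∀ w ∈ Set.Ioo (0 : ℝ) 1, a < w → w ≤ G x → quantile G w = x := by
    intro w hw haw hwx
    refine le_antisymm ((quantile_le_iff ν hw).mpr hwx) (le_of_forall_lt fun y hy => ?_)
    exact (lt_quantile_iff ν hw).mpr ((hno y hy).trans_lt haw)
  have h1 := hμν w₁ m₁ w₂ m₂ hw₁'.le
  rw [hq w₁ m₁ hw₁ (hw₁'.trans hw₂').le, hq w₂ m₂ hw₂ hw₂'.le, sub_self, mul_zero] at h1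
  have h2 : w₂ ≤ F (quantile F w₁) := (quantile_le_iff μ m₂).mp (by linarith)
  have h3 : F (quantile F w₁) ≤ w₁ := by
    have hlim : Tendsto F (𝓝[<] (quantile F w₁)) (𝓝 (F (quantile F w₁))) :=
      hcont.continuousAt.tendsto.mono_left nhdsWithin_le_nhds
    refine le_of_tendsto hlim ?_
    filter_upwards [self_mem_nhdsWithin] with y hy
    exact ((lt_quantile_iff μ m₁).mp hy).le
  linarith

/-! ### Marginals of laws on path space -/

variable {d : ℕ}

theorem continuous_eval_apply (γ : Fin d) (t : ℝ≥0) :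
    Continuous fun X : PathSpace d => X t γ :=
  (continuous_apply γ).comp (continuous_eval_const t)

/-- Sample paths are continuous, so dominated convergence applies to the integral of each bounded
continuous test function. -/
theorem continuous_marginal (μ : ProbabilityMeasure (PathSpace d)) (γ : Fin d) :
    Continuous (marginal μ γ) := by
  rw [continuous_iff_continuousAt]
  intro t
  rw [ContinuousAt, ProbabilityMeasure.tendsto_iff_forall_integral_tendsto]
  intro f
  have heq : ∀ s, ∫ y, f y ∂(marginal μ γ s : Measure ℝ) =
      ∫ X : PathSpace d, f (X s γ) ∂(μ : Measure (PathSpace d)) := fun s =>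
    integral_map (continuous_eval_apply γ s).measurable.aemeasurable
      f.continuous.measurable.aestronglyMeasurable
  simp only [heq]
  have hcont : Continuous fun s => ∫ X : PathSpace d, f (X s γ) ∂(μ : Measure (PathSpace d)) := by
    refine continuous_of_dominated (bound := fun _ => ‖f‖) (fun s => ?_) (fun s => ?_)
      (integrable_const _) ?_
    · exact (f.continuous.comp (continuous_eval_apply γ s)).measurable.aestronglyMeasurable
    · exact Eventually.of_forall fun X => f.norm_coe_le_norm _
    · exact Eventually.of_forall fun X =>
        f.continuous.comp ((continuous_apply γ).comp X.continuous)
  exact hcont.tendsto t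

/-- Moving to a nearby point on either side of `x` absorbs the variation of the second variable, and
weak convergence in time does the rest. Right continuity supplies the point for the upper bound,
`hleft` the one for the lower bound. -/
theorem continuousAt_cdf_marginal (μ : ProbabilityMeasure (PathSpace d)) (γ : Fin d) {t : ℝ≥0}
    {x : ℝ} (hleft : ∀ a < cdf (marginal μ γ t : Measure ℝ) x,
      ∃ y < x, a < cdf (marginal μ γ t : Measure ℝ) y) :
    ContinuousAt (fun p : ℝ≥0 × ℝ => cdf (marginal μ γ p.1 : Measure ℝ) p.2) (t, x) := by
  have hμ : Tendsto (fun p : ℝ≥0 × ℝ => marginal μ γ p.1) (𝓝 (t, x)) (𝓝 (marginal μ γ t)) :=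
    ((continuous_marginal μ γ).comp continuous_fst).tendsto (t, x)
  have hsnd : Tendsto (fun p : ℝ≥0 × ℝ => p.2) (𝓝 (t, x)) (𝓝 x) := continuous_snd.tendsto (t, x)
  refine tendsto_order.mpr ⟨fun a ha => ?_, fun a ha => ?_⟩
  · obtain ⟨y, hy, hay⟩ := hleft a ha
    obtain ⟨z, hyz, hzx⟩ := exists_between hy
    filter_upwards [eventually_lt_cdf hμ hay hyz, hsnd.eventually_const_lt hzx] with p h1 h2
    exact h1.trans_le (monotone_cdf _ h2.le)
  · have hlim : Tendsto (cdf (marginal μ γ t : Measure ℝ)) (𝓝[>] x)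
        (𝓝 (cdf (marginal μ γ t : Measure ℝ) x)) :=
      ((cdf (marginal μ γ t : Measure ℝ)).right_continuous x).mono_left
        (nhdsWithin_mono _ Set.Ioi_subset_Ici_self)
    obtain ⟨y, hya, hxy⟩ := ((hlim.eventually_lt_const ha).and self_mem_nhdsWithin).exists
    filter_upwards [eventually_cdf_lt hμ hya, hsnd.eventually_lt_const hxy] with p h1 h2
    exact (monotone_cdf _ h2.le).trans_lt h1

theorem tendsto_marginal {lam : Fin d → (Fin d → ℝ) → ℝ} {x : (n : ℕ) → Config d (n + 1)}
    {ℓ : ℕ → ℕ} {μ : ProbabilityMeasure (PathSpace d)}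
    (h : Tendsto (fun i => empirical (mspdPath lam (x (ℓ i)))) atTop (𝓝 μ)) (γ : Fin d) (t : ℝ≥0) :
    Tendsto (fun i => empirical (mspd lam (x (ℓ i)) t γ)) atTop (𝓝 (marginal μ γ t)) := by
  have h1 := ProbabilityMeasure.tendsto_map_of_tendsto_of_continuous _ _ h
    (continuous_eval_apply γ t)
  refine h1.congr fun i => ?_
  rw [empirical_map _ (continuous_eval_apply γ t).measurable]
  rfl

end Spreading

end MSPD

end

/-! ### Spreading and continuity for limit solutions -/

theorem corollary5p2 {d : ℕ} (lam : Fin d → (Fin d → ℝ) → ℝ) (L c : ℝ)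
    (hL : MSPD.LipschitzFields lam L) (hc : MSPD.UniformlyStrictlyHyperbolic lam c)
    (γ : Fin d) (hγ : MSPD.IsRarefactionCoordinate lam γ)
    (m : Fin d → ProbabilityMeasure ℝ) (u : Fin d → ℝ≥0 → ℝ → ℝ)
    (hu : MSPD.IsLimitSolution lam m u) :
    (∀ s t : ℝ≥0, s ≤ t → ∀ v₁ ∈ Set.Ioo (0 : ℝ) 1, ∀ v₂ ∈ Set.Ioo (0 : ℝ) 1, v₁ ≤ v₂ →
      (1 / MSPD.spreadingConst d L c) *
          (MSPD.quantile (u γ s) v₂ - MSPD.quantile (u γ s) v₁) ≤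
        MSPD.quantile (u γ t) v₂ - MSPD.quantile (u γ t) v₁) ∧
    (∀ s : ℝ≥0, Continuous (u γ s) →
      ContinuousOn (fun p : ℝ≥0 × ℝ => u γ p.1 p.2) (Set.Ici s ×ˢ Set.univ)) ∧
    (∀ δ : ℝ, 0 < δ → ∀ s t : ℝ≥0, s ≤ t →
      MSPD.modulus (u γ t) δ ≤ MSPD.modulus (u γ s) (MSPD.spreadingConst d L c * δ)) := by
  obtain ⟨x, hx, -, ℓ, μ, -, hμ, hu⟩ := hu
  have hK : 0 < MSPD.spreadingConst d L c := Real.exp_pos _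
  have hu' : ∀ t, u γ t = ProbabilityTheory.cdf (MSPD.marginal μ γ t : Measure ℝ) :=
    fun t => funext (hu γ t)
  have key : ∀ s t : ℝ≥0, s ≤ t → ∀ v₁ ∈ Set.Ioo (0 : ℝ) 1, ∀ v₂ ∈ Set.Ioo (0 : ℝ) 1, v₁ ≤ v₂ →
      MSPD.quantile (ProbabilityTheory.cdf (MSPD.marginal μ γ s : Measure ℝ)) v₂ -
          MSPD.quantile (ProbabilityTheory.cdf (MSPD.marginal μ γ s : Measure ℝ)) v₁ ≤
        MSPD.spreadingConst d L c *
          (MSPD.quantile (ProbabilityTheory.cdf (MSPD.marginal μ γ t : Measure ℝ)) v₂ -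
            MSPD.quantile (ProbabilityTheory.cdf (MSPD.marginal μ γ t : Measure ℝ)) v₁) :=
    fun s t hst v₁ hv₁ v₂ hv₂ hv => MSPD.quantile_sub_le_of_tendsto
      (fun i => (MSPD.mspd_rarefaction hL hc hγ (hx (ℓ i) γ)).1 s s.2)
      (fun i => (MSPD.mspd_rarefaction hL hc hγ (hx (ℓ i) γ)).1 t t.2) hK.le
      (fun i j k hjk => MSPD.mspd_spreading hL hc hγ (hx (ℓ i) γ) hjk s.2 hst)
      (MSPD.tendsto_marginal hμ γ s) (MSPD.tendsto_marginal hμ γ t) hv₁ hv₂ hv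
  refine ⟨fun s t hst v₁ hv₁ v₂ hv₂ hv => ?_, fun s hs => ?_, fun δ hδ s t hst => ?_⟩
  · rw [one_div, inv_mul_le_iff₀ hK, hu', hu']
    exact key s t hst v₁ hv₁ v₂ hv₂ hv
  · rintro ⟨t, y⟩ ⟨ht, -⟩
    rw [hu'] at hs
    simp only [hu']
    -- Continuity at time `s` excludes jumps at every later time `t`, by the spreading of quantiles
    -- from `s` to `t`.
    exact (MSPD.continuousAt_cdf_marginal μ γ fun a ha =>
      MSPD.exists_lt_cdf_of_continuous (key s t ht) hs ha).continuousWithinAt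
  · rw [hu', hu']
    exact MSPD.modulus_cdf_le hK (key s t hst) hδ.le
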